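/- Fix $d\ge 2$. A state of $N$ qudits is a density matrix $\rho$ on $(\mathbb C^d)^{\otimes N}$. A measurement setting of party $i$ is an arbitrary POVM $x_i$ on $\mathbb C^d$ with finitely many outcomes, and $p(a_1,\dots,a_N|x_1,\dots,x_N)_\rho=\operatorname{tr}\big[(x_1(a_1)\otimes\cdots\otimes x_N(a_N))\rho\big]$. For a set $A$ of parties, $x_A$ and $a_A$ denote the settings and outcomes of the parties in $A$. * $\rho$ is *genuinely multipartite entangled* ($\rho\in\mathcal S_{GME}^{d,N}$) if it is not a convex combination of states each of which is a product state with respect to some partition of the $N$ parties into at least two nonempty blocks (the blocks may differ from term to term). * $\rho$ is *genuinely multipartite nonlocal* ($\rho\in\mathcal S_{GMNL}^{d,N}$) if there is no hybrid local hidden variable model, i.e. no weights $\wp_{A|A^c}\ge 0$ over the bipartitions $A|A^c$ into nonempty sets with $\sum\wp_{A|A^c}=1$, probability measures $\mu_{A|A^c}$, and response functions (conditional probability distributions, with no constraint on the correlations inside a group), the same for all choices of measurements, such that for all $x$ and $a$ $$p(a|x)_\rho=\sum_{A|A^c}\wp_{A|A^c}\int p(a_A|x_A,\lambda)\,p(a_{A^c}|x_{A^c},\lambda)\,d\mu_{A|A^c}(\lambda).$$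 * $\rho$ is *genuinely multipartite steerable* ($\rho\in\mathcal S_{GMS}^{d,N}$) if there is no hybrid local hidden state (LHS) model, i.e. no such decomposition over the directed bipartitions $A\to A^c$ (both orders of every bipartition) in which $p(a_{A^c}|x_{A^c},\lambda)$ is the quantum statistics of a state $\sigma_\lambda$ of the parties in $A^c$. * A bipartite state $\rho$ on $\mathcal H\otimes\mathcal K$ has an *LHS model* (from $\mathcal H$ to $\mathcal K$) if there are a probability measure $\mu$, response functions $p(a|E,\lambda)$ and states $\rho_\lambda$ on $\mathcal K$ with $\operatorname{tr}[(E_a\otimes F_b)\rho]=\int p(a|E,\lambda)\operatorname{tr}(F_b\rho_\lambda)\,d\mu(\lambda)$ for all POVMs $E$ on $\mathcal H$ and $F$ on $\mathcal K$. Let $W^\eta=\eta\,\frac{2P_{as}}{d(d-1)}+(1-\eta)\frac{I}{d^2}$ be the Werner state on $\mathbb C^d\otimes\mathbb C^d$, where $P_{as}$ is the projector onto the antisymmetric subspace. For $k,l\ge1$ let $V_k:\mathbb C^d\to(\mathbb C^d)^{\otimes k}$ be the isometry $|i\rangle\mapsto|i\rangle^{\otimes k}$, and let $\widetilde W^\eta_{A'B'}=(V_k\otimes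 V_l)W^\eta(V_k\otimes V_l)^\dagger$ be the lifted Werner state of $k+l$ qudits, where $A'$ is the set of the first $k$ and $B'$ the set of the last $l$ qudits. **Proposition.** Let $d\ge2$. 1. For all $N\ge 2$: $\ \mathcal S_{GMNL}^{d,N}\subseteq\mathcal S_{GMS}^{d,N}\subsetneq\mathcal S_{GME}^{d,N}$. 2. The interval $\frac1{d+1}<\eta<\frac{(3d-1)(d-1)^{d-1}d^{-d}}{d+1}$ is nonempty, and for all $k,l\ge1$ and all $\eta$ in it, $\widetilde W^\eta_{A'B'}$ is a state with $\widetilde W^\eta_{A'B'}\in\mathcal S_{GME}^{d,k+l}$ and $\widetilde W^\eta_{A'B'}\notin\mathcal S_{GMS}^{d,k+l}$; moreover it has an LHS model from $A'$ to $B'$ across the bipartition $A'|B'$, for all POVMs on $A'$ and all POVMs on $B'$. -/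

import Mathlib

open MeasureTheory
open scoped ComplexOrder Kronecker

noncomputable section

/-- A density matrix. -/
def IsState {n : Type*} [Fintype n] (ρ : Matrix n n ℂ) : Prop :=
  ρ.PosSemidef ∧ ρ.trace = 1

/-- A POVM on the finite-dimensional space with basis `n`, with outcomes in `O`. -/
structure POVM (n O : Type*) [Fintype n] [DecidableEq n] [Fintype O] where
  effect : O → Matrix n n ℂ
  posSemidef : ∀ a, (effect a).PosSemidef
  sum_eq_one : ∑ a, effect a = 1

/-- A measurement setting of a single party: an arbitrary POVM on `ℂ^d` with finitely many
outcomes. -/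
structure Setting (d : ℕ) where
  outcomes : ℕ
  povm : POVM (Fin d) (Fin outcomes)

/-- A table of numbers `p(a | x)` for a group `ι` of parties, where `x` chooses a local POVM for
every party of the group and `a` is the corresponding tuple of outcomes. -/
def Behaviour (ι : Type*) (d : ℕ) : Type _ :=
  (x : ι → Setting d) → ((i : ι) → Fin (x i).outcomes) → ℝ

/-- For all settings, `p(· | x)` is a probability distribution on the tuples of outcomes. -/
def Behaviour.IsStochastic {ι : Type*} [Fintype ι] [DecidableEq ι] {d : ℕ}
    (p : Behaviour ι d) : Prop :=
  ∀ x, (∀ a, 0 ≤ p x a) ∧ ∑ a, p x a = 1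

/-- The tensor product `⨂ i, M i` of single-party operators, as a matrix in the product basis. -/
def localTensor {ι : Type*} [Fintype ι] {d : ℕ} (M : ι → Matrix (Fin d) (Fin d) ℂ) :
    Matrix (ι → Fin d) (ι → Fin d) ℂ :=
  Matrix.of fun s t => ∏ i, M i (s i) (t i)

/-- The quantum statistics `p(a | x)_ρ = tr ((⨂ i, x_i(a_i)) ρ)` (the trace is real when `ρ` is
a state). -/
def bornRule {ι : Type*} [Fintype ι] [DecidableEq ι] {d : ℕ}
    (ρ : Matrix (ι → Fin d) (ι → Fin d) ℂ) : Behaviour ι d :=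
  fun x a => (Matrix.trace (localTensor (fun i => (x i).povm.effect (a i)) * ρ)).re

/-- A response function of a group `ι` of parties with hidden variable in `Λ`. The group as a whole
outputs a joint distribution of outcomes; no constraint is put on the correlations inside it. -/
def IsResponse {ι Λ : Type*} [Fintype ι] [DecidableEq ι] [MeasurableSpace Λ] {d : ℕ}
    (R : Λ → Behaviour ι d) : Prop :=
  (∀ v, (R v).IsStochastic) ∧ ∀ x a, Measurable fun v => R v x a

/-- A measurable family of (hidden) states. -/
def IsStateFamily {n Λ : Type*} [Fintype n] [MeasurableSpace Λ] (σ : Λ → Matrix n n ℂ) : Prop :=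
  (∀ v, IsState (σ v)) ∧ ∀ s t, Measurable fun v => σ v s t

/-! ### Genuine multipartite entanglement -/

/-- `ρ` is a product state with respect to the partition `P` of the parties:
`ρ = ⨂ B ∈ P, τ_B`, where `τ_B` is a state of the parties in the block `B`. -/
def IsProductState {d N : ℕ} (P : Finpartition (Finset.univ : Finset (Fin N)))
    (ρ : Matrix (Fin N → Fin d) (Fin N → Fin d) ℂ) : Prop :=
  ∃ τ : (B : Finset (Fin N)) → Matrix (B → Fin d) (B → Fin d) ℂ,
    (∀ B ∈ P.parts, IsState (τ B)) ∧
    ρ = Matrix.of fun s t => ∏ B ∈ P.parts, τ B (fun i => s i) (fun i => t i)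

/-- A mixture of states, each of which is a product state with respect to some partition of the
parties into at least two blocks. -/
def HybridSeparable {d N : ℕ} (ρ : Matrix (Fin N → Fin d) (Fin N → Fin d) ℂ) : Prop :=
  ρ ∈ convexHull ℝ {σ : Matrix (Fin N → Fin d) (Fin N → Fin d) ℂ |
    ∃ P : Finpartition (Finset.univ : Finset (Fin N)), 2 ≤ P.parts.card ∧ IsProductState P σ}

/-- The set of genuinely multipartite entangled states of `N` qudits. -/
def GME (d N : ℕ) : Set (Matrix (Fin N → Fin d) (Fin N → Fin d) ℂ) :=
  {ρ | IsState ρ ∧ ¬ HybridSeparable ρ}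

/-! ### Genuine multipartite nonlocality -/

/-- The (unordered) bipartitions `A | Aᶜ` of `N` parties. -/
def bipartitions (N : ℕ) : Finset (Finpartition (Finset.univ : Finset (Fin N))) :=
  Finset.univ.filter fun P => P.parts.card = 2

/-- `q` has a local hidden variable model across the blocks of `P`:
`q(a | x) = ∫ ∏_B p(a_B | x_B, v) dμ(v)`. -/
def HasLHVAcross {d N : ℕ} (P : Finpartition (Finset.univ : Finset (Fin N)))
    (q : Behaviour (Fin N) d) : Prop :=
  ∃ (Λ : Type) (_ : MeasurableSpace Λ) (μ : Measure Λ)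
    (R : (B : Finset (Fin N)) → Λ → Behaviour B d),
    IsProbabilityMeasure μ ∧ (∀ B ∈ P.parts, IsResponse (R B)) ∧
    ∀ x a, q x a = ∫ v, ∏ B ∈ P.parts, R B v (fun i => x i) (fun i => a i) ∂μ

/-- A convex combination, over all bipartitions, of behaviours with a local hidden variable model
across the respective bipartition. The same model has to serve all choices of measurements. -/
def HybridLHV {d N : ℕ} (p : Behaviour (Fin N) d) : Prop :=
  ∃ (w : Finpartition (Finset.univ : Finset (Fin N)) → ℝ)
    (q : Finpartition (Finset.univ : Finset (Fin N)) → Behaviour (Fin N) d),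
    (∀ P ∈ bipartitions N, 0 ≤ w P ∧ HasLHVAcross P (q P)) ∧
    ∑ P ∈ bipartitions N, w P = 1 ∧
    ∀ x a, p x a = ∑ P ∈ bipartitions N, w P * q P x a

/-- The set of genuinely multipartite nonlocal states of `N` qudits. -/
def GMNL (d N : ℕ) : Set (Matrix (Fin N → Fin d) (Fin N → Fin d) ℂ) :=
  {ρ | IsState ρ ∧ ¬ HybridLHV (bornRule ρ)}

/-! ### Genuine multipartite steering -/

/-- The directed bipartitions of `N` parties, each given by its steering side `A`; the other side,
which holds the hidden quantum states, is `Aᶜ`. -/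
def directedBipartitions (N : ℕ) : Finset (Finset (Fin N)) :=
  Finset.univ.filter fun A => A.Nonempty ∧ A ≠ Finset.univ

/-- `q` has a local hidden state model from the group `A` to the group `Aᶜ`:
`q(a, b | x) = ∫ p(a | x_A, v) p_Q(b | x_{Aᶜ}, v) dμ(v)`, where `p_Q(· | ·, v)` are the quantum
statistics of a state `σ v` of the parties in `Aᶜ`. -/
def HasLHSAcross {d N : ℕ} (A : Finset (Fin N)) (q : Behaviour (Fin N) d) : Prop :=
  ∃ (Λ : Type) (_ : MeasurableSpace Λ) (μ : Measure Λ) (R : Λ → Behaviour A d)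
    (σ : Λ → Matrix ((Aᶜ : Finset (Fin N)) → Fin d) ((Aᶜ : Finset (Fin N)) → Fin d) ℂ),
    IsProbabilityMeasure μ ∧ IsResponse R ∧ IsStateFamily σ ∧
    ∀ x a, q x a = ∫ v, R v (fun i => x i) (fun i => a i) *
      bornRule (σ v) (fun i => x i) (fun i => a i) ∂μ

/-- A convex combination, over all directed bipartitions, of behaviours with a local hidden state
model for the respective directed bipartition. -/
def HybridLHS {d N : ℕ} (p : Behaviour (Fin N) d) : Prop :=
  ∃ (w : Finset (Fin N) → ℝ) (q : Finset (Fin N) → Behaviour (Fin N) d),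
    (∀ A ∈ directedBipartitions N, 0 ≤ w A ∧ HasLHSAcross A (q A)) ∧
    ∑ A ∈ directedBipartitions N, w A = 1 ∧
    ∀ x a, p x a = ∑ A ∈ directedBipartitions N, w A * q A x a

/-- The set of genuinely multipartite steerable states of `N` qudits. -/
def GMS (d N : ℕ) : Set (Matrix (Fin N → Fin d) (Fin N → Fin d) ℂ) :=
  {ρ | IsState ρ ∧ ¬ HybridLHS (bornRule ρ)}

/-! ### Bipartite local hidden state models and the lifted Werner states -/

/-- The bipartite state `ρ` on `ℂ^m ⊗ ℂ^n` has a local hidden state model from the first to the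
second side for all POVMs on `ℂ^m` and all POVMs on `ℂ^n`. -/
def HasLHSModel {m n : Type*} [Fintype m] [DecidableEq m] [Fintype n] [DecidableEq n]
    (ρ : Matrix (m × n) (m × n) ℂ) : Prop :=
  ∃ (Λ : Type) (_ : MeasurableSpace Λ) (μ : Measure Λ)
    (R : Λ → (o : ℕ) → POVM m (Fin o) → Fin o → ℝ) (σ : Λ → Matrix n n ℂ),
    IsProbabilityMeasure μ ∧
    (∀ v o E, (∀ a, 0 ≤ R v o E a) ∧ ∑ a, R v o E a = 1) ∧
    (∀ o E a, Measurable fun v => R v o E a) ∧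
    IsStateFamily σ ∧
    ∀ (o o' : ℕ) (E : POVM m (Fin o)) (F : POVM n (Fin o')) (a : Fin o) (b : Fin o'),
      (Matrix.trace ((E.effect a ⊗ₖ F.effect b) * ρ)).re =
        ∫ v, R v o E a * (Matrix.trace (F.effect b * σ v)).re ∂μ

/-- The swap operator on `ℂ^d ⊗ ℂ^d`. -/
def swapOp (d : ℕ) : Matrix (Fin d × Fin d) (Fin d × Fin d) ℂ :=
  Matrix.of fun p q => if p.1 = q.2 ∧ p.2 = q.1 then 1 else 0

/-- The projector onto the antisymmetric subspace of `ℂ^d ⊗ ℂ^d`. -/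
def antisymProj (d : ℕ) : Matrix (Fin d × Fin d) (Fin d × Fin d) ℂ :=
  (1 / 2 : ℂ) • (1 - swapOp d)

/-- The Werner state `η · 2 P_as / (d (d - 1)) + (1 - η) · I / d ^ 2`. -/
def werner (d : ℕ) (η : ℝ) : Matrix (Fin d × Fin d) (Fin d × Fin d) ℂ :=
  ((η : ℂ) * (2 / ((d : ℂ) * ((d : ℂ) - 1)))) • antisymProj d +
    ((1 - (η : ℂ)) / (d : ℂ) ^ 2) • 1

/-- The isometry `ℂ^d → (ℂ^d)^{⊗ k}` that sends `|i⟩` to `|i⟩^{⊗ k}`. -/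
def repIsometry (d k : ℕ) : Matrix (Fin k → Fin d) (Fin d) ℂ :=
  Matrix.of fun s i => if s = (fun _ => i) then 1 else 0

/-- The lifted Werner state on `A' B'`, where `A'` consists of `k` and `B'` of `l` qudits: the image
of the Werner state under `|i⟩ ⊗ |j⟩ ↦ |i⟩^{⊗ k} ⊗ |j⟩^{⊗ l}`. -/
def liftedWerner (d k l : ℕ) (η : ℝ) :
    Matrix ((Fin k → Fin d) × (Fin l → Fin d)) ((Fin k → Fin d) × (Fin l → Fin d)) ℂ :=
  (repIsometry d k ⊗ₖ repIsometry d l) * werner d η *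
    (repIsometry d k ⊗ₖ repIsometry d l).conjTranspose

/-- A bipartite operator on `k` and `l` qudits seen as an operator on `k + l` qudits, of which the
first `k` form the first side. -/
def toParties {d k l : ℕ}
    (ρ : Matrix ((Fin k → Fin d) × (Fin l → Fin d)) ((Fin k → Fin d) × (Fin l → Fin d)) ℂ) :
    Matrix (Fin (k + l) → Fin d) (Fin (k + l) → Fin d) ℂ :=
  Matrix.reindex (Fin.appendEquiv k l) (Fin.appendEquiv k l) ρ

/-- The upper end `(3d - 1) (d - 1)^(d - 1) d^(-d) / (d + 1)` of the visibility range. -/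
def visibilityBound (d : ℕ) : ℝ :=
  (3 * (d : ℝ) - 1) * ((d : ℝ) - 1) ^ (d - 1) * ((d : ℝ) ^ d)⁻¹ / ((d : ℝ) + 1)

end

/-!
Genuine multipartite nonlocality, steering and entanglement form a hierarchy, which is strict at the
last step because the lifted Werner states are entangled and yet have a local hidden state model.

*The inclusions.* The behaviours with a local hidden state model across a fixed `A | Aᶜ` form a
convex set, since the hidden variables of two models can be put side by side; so do those with a
local hidden variable model. A hybrid model is therefore a point of the convex hull of a union of
such sets (`hybridLHS_iff`, `hybridLHV_iff`). A hidden state is a hidden variable, which gives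
`HybridLHS.hybridLHV`. The Born rule is linear and sends a product state to a behaviour with a
trivial local hidden state model, which gives `HybridSeparable.hybridLHS`.

*Entanglement.* The witness is the swap operator on the span of the strings `i … i j … j`
(`swapWitness`). On a Werner state it has the value `(1 - η) / d - η`, which is negative for
`η > 1 / (d + 1)`. All terms of a decomposition of a lifted Werner state are supported on that span,
and for product states so supported the value is nonnegative (`swapWitness_nonneg_of_product`):
across `A' | B'` it is the trace of a product of two positive operators, and any other bipartition
splits one of the two blocks, where the support condition kills the off-diagonal terms.

*The local hidden state model.* It suffices to treat the Werner state itself, as local isometries can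
be absorbed into the model (`HasLHSModel.conjugate`). The model is Barrett's. The hidden variable is a
Gaussian vector `v` of `ℂ^d`, of which only the direction matters. The first side decomposes its
effects into multiples `x |φ⟩⟨φ|` of rank one projectors, accepts such an effect with probability `x u`
if the overlap `u` of `|φ⟩` with the direction of `v` is at least `1/d`, and answers at random,
with weights proportional to the traces of the effects, if nothing has been accepted
(`exists_acceptance`, `exists_response`). The second side holds a mixture of the identity and
`I - |v⟩⟨v| / ‖v‖²`. By unitary invariance of the Gaussian measure, the directions accepted for `|φ⟩`
average to a combination of `|φ⟩⟨φ|` and `I` (`integral_threshold_mul_direction`), as the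
Werner state requires. The attainable visibility is governed by the expectation of
`u (d u - 1) 1{u ≥ 1/d}`. Since `u ≥ s` has probability `(1 - s)^(d - 1)`
(`complexGaussian_le_overlap`), this is an elementary integral, whose value is the visibility bound
up to the factor `(d - 1) / d` (`integral_threshold_gain`).
-/

noncomputable section

/-! ### Positive operators and the Born rule -/

open scoped MatrixOrder in
theorem Matrix.PosSemidef.exists_eq_conjTranspose_mul_self {n : Type*} [Fintype n]
    {A : Matrix n n ℂ} (hA : A.PosSemidef) : ∃ C : Matrix n n ℂ, A = C.conjTranspose * C := by
  classical
  exact CStarAlgebra.nonneg_iff_eq_star_mul_self.mp hA.nonneg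

/-- The trace of a product of two positive semidefinite matrices is real and nonnegative. -/
theorem Matrix.PosSemidef.trace_mul_nonneg {n : Type*} [Fintype n] {A B : Matrix n n ℂ}
    (hA : A.PosSemidef) (hB : B.PosSemidef) : 0 ≤ (A * B).trace := by
  classical
  obtain ⟨C, rfl⟩ := hA.exists_eq_conjTranspose_mul_self
  rw [Matrix.mul_assoc, Matrix.trace_mul_comm]
  exact (hB.mul_mul_conjTranspose_same C).trace_nonneg

theorem localTensor_mul {ι : Type*} [Fintype ι] [DecidableEq ι] {d : ℕ}
    (M M' : ι → Matrix (Fin d) (Fin d) ℂ) :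
    localTensor M * localTensor M' = localTensor fun i => M i * M' i := by
  ext s t
  simp only [localTensor, Matrix.mul_apply, Matrix.of_apply, ← Finset.prod_mul_distrib]
  rw [Finset.prod_univ_sum, Fintype.piFinset_univ]

theorem localTensor_conjTranspose {ι : Type*} [Fintype ι] {d : ℕ}
    (M : ι → Matrix (Fin d) (Fin d) ℂ) :
    (localTensor M).conjTranspose = localTensor fun i => (M i).conjTranspose := by
  ext s t
  simp [localTensor, Matrix.conjTranspose_apply]

theorem localTensor_one {ι : Type*} [Fintype ι] [DecidableEq ι] {d : ℕ} :
    localTensor (fun _ : ι => (1 : Matrix (Fin d) (Fin d) ℂ)) = 1 := by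
  ext s t
  simp only [localTensor, Matrix.of_apply, Matrix.one_apply, Finset.prod_ite_zero,
    Finset.prod_const_one, funext_iff, Finset.mem_univ, true_implies]

theorem localTensor_posSemidef {ι : Type*} [Fintype ι] [DecidableEq ι] {d : ℕ}
    {M : ι → Matrix (Fin d) (Fin d) ℂ} (hM : ∀ i, (M i).PosSemidef) :
    (localTensor M).PosSemidef := by
  choose B hB using fun i => (hM i).exists_eq_conjTranspose_mul_self
  have : localTensor M = (localTensor B).conjTranspose * localTensor B := by
    rw [localTensor_conjTranspose, localTensor_mul]
    exact congrArg _ (funext hB)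
  rw [this]
  exact Matrix.posSemidef_conjTranspose_mul_self _

theorem sum_localTensor {ι : Type*} [Fintype ι] [DecidableEq ι] {d : ℕ} {o : ι → ℕ}
    (M : (i : ι) → Fin (o i) → Matrix (Fin d) (Fin d) ℂ) :
    ∑ a : (i : ι) → Fin (o i), localTensor (fun i => M i (a i)) =
      localTensor fun i => ∑ a, M i a := by
  ext s t
  simp only [localTensor, Matrix.sum_apply, Matrix.of_apply]
  rw [Finset.prod_univ_sum, Fintype.piFinset_univ]

/-- The local measurements of a group of parties, combined into one POVM of the whole group. -/
def jointPOVM {ι : Type*} [Fintype ι] [DecidableEq ι] {d : ℕ} (x : ι → Setting d) :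
    POVM (ι → Fin d) ((i : ι) → Fin (x i).outcomes) where
  effect a := localTensor fun i => (x i).povm.effect (a i)
  posSemidef a := localTensor_posSemidef fun i => (x i).povm.posSemidef _
  sum_eq_one := by
    rw [sum_localTensor]
    simp only [(fun i => (x i).povm.sum_eq_one), localTensor_one]

theorem bornRule_eq_trace_jointPOVM {ι : Type*} [Fintype ι] [DecidableEq ι] {d : ℕ}
    (ρ : Matrix (ι → Fin d) (ι → Fin d) ℂ) (x : ι → Setting d)
    (a : (i : ι) → Fin (x i).outcomes) :
    bornRule ρ x a = (Matrix.trace ((jointPOVM x).effect a * ρ)).re := rfl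

theorem bornRule_isStochastic {ι : Type*} [Fintype ι] [DecidableEq ι] {d : ℕ}
    {ρ : Matrix (ι → Fin d) (ι → Fin d) ℂ} (hρ : IsState ρ) :
    (bornRule ρ).IsStochastic := by
  intro x
  refine ⟨fun a => ?_, ?_⟩
  · exact (Complex.le_def.1 (((jointPOVM x).posSemidef a).trace_mul_nonneg hρ.1)).1
  · simp only [bornRule_eq_trace_jointPOVM]
    rw [← Complex.re_sum, ← Matrix.trace_sum, ← Finset.sum_mul, (jointPOVM x).sum_eq_one,
      Matrix.one_mul, hρ.2, Complex.one_re]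

theorem Behaviour.IsStochastic.le_one {ι : Type*} [Fintype ι] [DecidableEq ι] {d : ℕ}
    {p : Behaviour ι d} (hp : p.IsStochastic) (x : ι → Setting d)
    (a : (i : ι) → Fin (x i).outcomes) : p x a ≤ 1 := by
  rw [← (hp x).2]
  exact Finset.single_le_sum (fun b _ => (hp x).1 b) (Finset.mem_univ a)

theorem measurable_bornRule {ι Λ : Type*} [Fintype ι] [DecidableEq ι] [MeasurableSpace Λ] {d : ℕ}
    {σ : Λ → Matrix (ι → Fin d) (ι → Fin d) ℂ} (hσ : ∀ s t, Measurable fun v => σ v s t)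
    (x : ι → Setting d) (a : (i : ι) → Fin (x i).outcomes) :
    Measurable fun v => bornRule (σ v) x a := by
  simp only [bornRule, Matrix.trace, Matrix.diag, Matrix.mul_apply]
  fun_prop

theorem IsStateFamily.isResponse_bornRule {ι Λ : Type*} [Fintype ι] [DecidableEq ι]
    [MeasurableSpace Λ] {d : ℕ} {σ : Λ → Matrix (ι → Fin d) (ι → Fin d) ℂ}
    (hσ : IsStateFamily σ) : IsResponse fun v => bornRule (σ v) :=
  ⟨fun v => bornRule_isStochastic (hσ.1 v), measurable_bornRule hσ.2⟩

instance {ι : Type*} {d : ℕ} : AddCommGroup (Behaviour ι d) :=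
  inferInstanceAs (AddCommGroup ((x : ι → Setting d) → ((i : ι) → Fin (x i).outcomes) → ℝ))

instance {ι : Type*} {d : ℕ} : Module ℝ (Behaviour ι d) :=
  inferInstanceAs (Module ℝ ((x : ι → Setting d) → ((i : ι) → Fin (x i).outcomes) → ℝ))

theorem Behaviour.add_apply {ι : Type*} {d : ℕ} (p q : Behaviour ι d) (x : ι → Setting d)
    (a : (i : ι) → Fin (x i).outcomes) : (p + q) x a = p x a + q x a := rfl

theorem Behaviour.smul_apply {ι : Type*} {d : ℕ} (t : ℝ) (p : Behaviour ι d) (x : ι → Setting d)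
    (a : (i : ι) → Fin (x i).outcomes) : (t • p) x a = t * p x a := rfl

theorem Behaviour.sum_apply {ι κ : Type*} {d : ℕ} (s : Finset κ) (p : κ → Behaviour ι d)
    (x : ι → Setting d) (a : (i : ι) → Fin (x i).outcomes) :
    (∑ k ∈ s, p k) x a = ∑ k ∈ s, p k x a := by
  change (∑ k ∈ s, (show (x : ι → Setting d) → ((i : ι) → Fin (x i).outcomes) → ℝ from p k)) x a = _
  rw [Finset.sum_apply, Finset.sum_apply]

theorem Behaviour.ext {ι : Type*} {d : ℕ} {p q : Behaviour ι d} (h : ∀ x a, p x a = q x a) :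
    p = q := funext fun x => funext fun a => h x a

/-- The Born rule as a linear map from operators to behaviours. -/
def bornRuleLinear (ι : Type*) [Fintype ι] [DecidableEq ι] (d : ℕ) :
    Matrix (ι → Fin d) (ι → Fin d) ℂ →ₗ[ℝ] Behaviour ι d where
  toFun := bornRule
  map_add' ρ σ := Behaviour.ext fun x a => by
    simp [bornRule, Behaviour.add_apply, Matrix.mul_add]
  map_smul' t ρ := Behaviour.ext fun x a => by
    simp [bornRule, Behaviour.smul_apply]

/-! ### Mixtures of hidden variable models -/

/-- The hidden variable is drawn from `μ` with probability `s` and from `ν` with probability `t`. -/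
def mixedMeasure {Λ Λ' : Type*} [MeasurableSpace Λ] [MeasurableSpace Λ'] (μ : Measure Λ)
    (ν : Measure Λ') (s t : ℝ) : Measure (Λ ⊕ Λ') :=
  ENNReal.ofReal s • μ.map Sum.inl + ENNReal.ofReal t • ν.map Sum.inr

theorem isProbabilityMeasure_mixedMeasure {Λ Λ' : Type*} [MeasurableSpace Λ] [MeasurableSpace Λ']
    (μ : Measure Λ) (ν : Measure Λ') [IsProbabilityMeasure μ] [IsProbabilityMeasure ν] {s t : ℝ}
    (hs : 0 ≤ s) (ht : 0 ≤ t) (hst : s + t = 1) :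
    IsProbabilityMeasure (mixedMeasure μ ν s t) := by
  constructor
  rw [mixedMeasure, Measure.add_apply, Measure.smul_apply, Measure.smul_apply,
    Measure.map_apply measurable_inl .univ, Measure.map_apply measurable_inr .univ]
  simp [← ENNReal.ofReal_add hs ht, hst]

theorem integral_mixedMeasure {Λ Λ' : Type*} [MeasurableSpace Λ] [MeasurableSpace Λ']
    {μ : Measure Λ} {ν : Measure Λ'} {s t : ℝ} (hs : 0 ≤ s) (ht : 0 ≤ t) {f : Λ ⊕ Λ' → ℝ}
    (hf : Integrable (fun v => f (Sum.inl v)) μ) (hg : Integrable (fun v => f (Sum.inr v)) ν) :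
    ∫ v, f v ∂(mixedMeasure μ ν s t) =
      s * ∫ v, f (Sum.inl v) ∂μ + t * ∫ v, f (Sum.inr v) ∂ν := by
  have inl : MeasurableEmbedding (Sum.inl : Λ → Λ ⊕ Λ') :=
    ⟨Sum.inl_injective, measurable_inl, fun {_} h => MeasurableSet.inl_image h⟩
  have inr : MeasurableEmbedding (Sum.inr : Λ' → Λ ⊕ Λ') :=
    ⟨Sum.inr_injective, measurable_inr, fun {_} h => MeasurableSet.inr_image h⟩
  have hf' : Integrable f (μ.map Sum.inl) :=
    inl.integrable_map_iff.2 hf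
  have hg' : Integrable f (ν.map Sum.inr) :=
    inr.integrable_map_iff.2 hg
  rw [mixedMeasure, integral_add_measure (hf'.smul_measure ENNReal.ofReal_ne_top)
    (hg'.smul_measure ENNReal.ofReal_ne_top), integral_smul_measure, integral_smul_measure,
    inl.integral_map, inr.integral_map,
    ENNReal.toReal_ofReal hs, ENNReal.toReal_ofReal ht, smul_eq_mul, smul_eq_mul]

/-- Measurable functions with values in `[0, 1]` are integrable for a probability measure. -/
theorem integrable_of_mem_unitInterval {Λ : Type*} [MeasurableSpace Λ] {μ : Measure Λ}
    [IsProbabilityMeasure μ] {f : Λ → ℝ} (hf : Measurable f) (h0 : ∀ v, 0 ≤ f v)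
    (h1 : ∀ v, f v ≤ 1) : Integrable f μ :=
  .of_bound hf.aestronglyMeasurable 1
    (.of_forall fun v => by rw [Real.norm_eq_abs, abs_of_nonneg (h0 v)]; exact h1 v)

theorem IsResponse.sumElim {ι Λ Λ' : Type*} [Fintype ι] [DecidableEq ι] [MeasurableSpace Λ]
    [MeasurableSpace Λ'] {d : ℕ} {R : Λ → Behaviour ι d} {R' : Λ' → Behaviour ι d}
    (hR : IsResponse R) (hR' : IsResponse R') : IsResponse (Sum.elim R R') :=
  ⟨by rintro (v | v); exacts [hR.1 v, hR'.1 v],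
    fun x a => measurable_fun_sum (by exact hR.2 x a) (by exact hR'.2 x a)⟩

theorem convex_hasLHSAcross {d N : ℕ} (A : Finset (Fin N)) :
    Convex ℝ {q : Behaviour (Fin N) d | HasLHSAcross A q} := by
  rintro q ⟨Λ, _, μ, R, σ, _, hR, hσ, hq⟩ q' ⟨Λ', _, μ', R', σ', _, hR', hσ', hq'⟩ s t hs ht hst
  have key : ∀ {Λ : Type} [MeasurableSpace Λ] (μ : Measure Λ) [IsProbabilityMeasure μ]
      {R : Λ → Behaviour A d} {σ : Λ → Matrix ((Aᶜ : Finset (Fin N)) → Fin d)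
        ((Aᶜ : Finset (Fin N)) → Fin d) ℂ} (_ : IsResponse R) (_ : IsStateFamily σ)
      (x : Fin N → Setting d) (a : (i : Fin N) → Fin (x i).outcomes),
      Integrable (fun v => R v (fun i => x i) (fun i => a i) *
        bornRule (σ v) (fun i => x i) (fun i => a i)) μ := by
    intro Λ _ μ _ R σ hR hσ x a
    exact integrable_of_mem_unitInterval
      ((hR.2 _ _).mul (measurable_bornRule hσ.2 _ _))
      (fun v => mul_nonneg ((hR.1 v _).1 _) ((bornRule_isStochastic (hσ.1 v) _).1 _))
      (fun v => mul_le_one₀ ((hR.1 v).le_one _ _) ((bornRule_isStochastic (hσ.1 v) _).1 _)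
        ((bornRule_isStochastic (hσ.1 v)).le_one _ _))
  refine ⟨Λ ⊕ Λ', inferInstance, mixedMeasure μ μ' s t, Sum.elim R R', Sum.elim σ σ',
    isProbabilityMeasure_mixedMeasure μ μ' hs ht hst, hR.sumElim hR', ⟨?_, ?_⟩, fun x a => ?_⟩
  · rintro (v | v)
    exacts [hσ.1 v, hσ'.1 v]
  · exact fun i j => measurable_fun_sum (by exact hσ.2 i j) (by exact hσ'.2 i j)
  · rw [integral_mixedMeasure hs ht (by exact key μ hR hσ x a) (by exact key μ' hR' hσ' x a),
      Behaviour.add_apply, Behaviour.smul_apply, Behaviour.smul_apply, hq, hq']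
    rfl

theorem convex_hasLHVAcross {d N : ℕ} (P : Finpartition (Finset.univ : Finset (Fin N))) :
    Convex ℝ {q : Behaviour (Fin N) d | HasLHVAcross P q} := by
  rintro q ⟨Λ, _, μ, R, _, hR, hq⟩ q' ⟨Λ', _, μ', R', _, hR', hq'⟩ s t hs ht hst
  have key : ∀ {Λ : Type} [MeasurableSpace Λ] (μ : Measure Λ) [IsProbabilityMeasure μ]
      {R : (B : Finset (Fin N)) → Λ → Behaviour B d} (_ : ∀ B ∈ P.parts, IsResponse (R B))
      (x : Fin N → Setting d) (a : (i : Fin N) → Fin (x i).outcomes),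
      Integrable (fun v => ∏ B ∈ P.parts, R B v (fun i => x i) (fun i => a i)) μ := by
    intro Λ _ μ _ R hR x a
    exact integrable_of_mem_unitInterval
      (Finset.measurable_prod _ fun B hB => (hR B hB).2 _ _)
      (fun v => Finset.prod_nonneg fun B hB => ((hR B hB).1 v _).1 _)
      (fun v => Finset.prod_le_one (fun B hB => ((hR B hB).1 v _).1 _)
        fun B hB => ((hR B hB).1 v).le_one _ _)
  refine ⟨Λ ⊕ Λ', inferInstance, mixedMeasure μ μ' s t, fun B => Sum.elim (R B) (R' B),
    isProbabilityMeasure_mixedMeasure μ μ' hs ht hst, fun B hB => (hR B hB).sumElim (hR' B hB),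
    fun x a => ?_⟩
  rw [integral_mixedMeasure hs ht (by exact key μ hR x a) (by exact key μ' hR' x a),
    Behaviour.add_apply, Behaviour.smul_apply, Behaviour.smul_apply, hq, hq']
  rfl

/-! ### Hybrid models as convex hulls -/

/-- The convex hull of a finite union of nonempty convex sets consists of the convex combinations
with one point from each of the sets. -/
theorem mem_convexHull_biUnion_iff {κ E : Type*} [AddCommGroup E] [Module ℝ E] {s : Finset κ}
    {C : κ → Set E} (hC : ∀ i ∈ s, Convex ℝ (C i)) (hne : ∀ i ∈ s, (C i).Nonempty) {x : E} :
    x ∈ convexHull ℝ (⋃ i ∈ s, C i) ↔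
      ∃ (w : κ → ℝ) (q : κ → E), (∀ i ∈ s, 0 ≤ w i ∧ q i ∈ C i) ∧ ∑ i ∈ s, w i = 1 ∧
        x = ∑ i ∈ s, w i • q i := by
  classical
  constructor
  · intro hx
    refine convexHull_min (t := {x | ∃ (w : κ → ℝ) (q : κ → E),
      (∀ i ∈ s, 0 ≤ w i ∧ q i ∈ C i) ∧ ∑ i ∈ s, w i = 1 ∧ x = ∑ i ∈ s, w i • q i}) ?_ ?_ hx
    · intro y hy
      obtain ⟨i, hi, hy⟩ := Set.mem_iUnion₂.1 hy
      choose! c hc using hne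
      refine ⟨Pi.single i 1, Function.update c i y, fun j hj => ⟨?_, ?_⟩, by simp [hi], ?_⟩
      · by_cases h : j = i
        · subst h; simp
        · simp [h]
      · by_cases h : j = i
        · subst h; simpa using hy
        · simpa [h] using hc j hj
      · rw [Finset.sum_eq_single i (fun j _ h => by simp [h]) (fun h => absurd hi h)]
        simp
    · rintro _ ⟨w, q, hw, hw1, rfl⟩ _ ⟨w', q', hw', hw1', rfl⟩ a b ha hb hab
      refine ⟨fun i => a * w i + b * w' i, fun i => if a * w i + b * w' i = 0 then q i else
        (a * w i / (a * w i + b * w' i)) • q i + (b * w' i / (a * w i + b * w' i)) • q' i,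
        fun i hi => ⟨?_, ?_⟩, ?_, ?_⟩
      · have := mul_nonneg ha (hw i hi).1
        have := mul_nonneg hb (hw' i hi).1
        positivity
      · have h1 := mul_nonneg ha (hw i hi).1
        have h2 := mul_nonneg hb (hw' i hi).1
        dsimp only
        split_ifs with h
        · exact (hw i hi).2
        · exact hC i hi (hw i hi).2 (hw' i hi).2 (by positivity) (by positivity)
            (by rw [← add_div, div_self h])
      · rw [Finset.sum_add_distrib, ← Finset.mul_sum, ← Finset.mul_sum, hw1, hw1']
        linarith
      · rw [Finset.smul_sum, Finset.smul_sum, ← Finset.sum_add_distrib]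
        refine Finset.sum_congr rfl fun i hi => ?_
        have h1 := mul_nonneg ha (hw i hi).1
        have h2 := mul_nonneg hb (hw' i hi).1
        dsimp only
        split_ifs with h
        · have e1 : a * w i = 0 := by linarith
          have e2 : b * w' i = 0 := by linarith
          simp [smul_smul, e1, e2]
        · rw [smul_add, smul_smul, smul_smul, smul_smul, smul_smul, mul_div_cancel₀ _ h,
            mul_div_cancel₀ _ h]
  · rintro ⟨w, q, hw, hw1, rfl⟩
    exact (convex_convexHull ℝ _).sum_mem (fun i hi => (hw i hi).1) hw1 fun i hi =>
      subset_convexHull ℝ _ (Set.mem_iUnion₂.2 ⟨i, hi, (hw i hi).2⟩)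

/-- Restricting a tuple to a group of parties and to its complement. -/
def splitEquiv (d : ℕ) {N : ℕ} (A : Finset (Fin N)) :
    (Fin N → Fin d) ≃ (A → Fin d) × ((Aᶜ : Finset (Fin N)) → Fin d) where
  toFun s := (fun i => s i, fun i => s i)
  invFun p i := if h : i ∈ A then p.1 ⟨i, h⟩ else p.2 ⟨i, Finset.mem_compl.2 h⟩
  left_inv s := by ext i; simp
  right_inv p := by
    ext i
    · simp
    · simp [Finset.mem_compl.1 i.2]

theorem splitEquiv_symm_apply_of_notMem {d N : ℕ} {A : Finset (Fin N)} (r : A → Fin d)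
    (s : Fin N → Fin d) {i : Fin N} (hi : i ∉ A) :
    (splitEquiv d A).symm (r, fun i => s i) i = s i := by
  simp [splitEquiv, hi]

theorem prod_eq_prod_mul_prod_compl {N : ℕ} (A : Finset (Fin N)) (f : Fin N → ℂ) :
    ∏ i, f i = (∏ i : A, f i) * ∏ i : (Aᶜ : Finset (Fin N)), f i := by
  rw [Finset.prod_coe_sort A f, Finset.prod_coe_sort Aᶜ f, Finset.prod_mul_prod_compl]

theorem IsState.nonempty {n : Type*} [Fintype n] {ρ : Matrix n n ℂ} (h : IsState ρ) :
    Nonempty n := by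
  by_contra hn
  rw [not_nonempty_iff] at hn
  have := h.2
  simp [Matrix.trace] at this

/-- The Born rule is multiplicative on states that are products across `A | Aᶜ`. -/
theorem bornRule_product {d N : ℕ} (A : Finset (Fin N))
    {ρ : Matrix (Fin N → Fin d) (Fin N → Fin d) ℂ} {τ : Matrix (A → Fin d) (A → Fin d) ℂ}
    {σ : Matrix ((Aᶜ : Finset (Fin N)) → Fin d) ((Aᶜ : Finset (Fin N)) → Fin d) ℂ}
    (hτ : IsState τ) (h : ∀ s t : Fin N → Fin d,
      ρ s t = τ (fun i => s i) (fun i => t i) * σ (fun i => s i) (fun i => t i))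
    (x : Fin N → Setting d) (a : (i : Fin N) → Fin (x i).outcomes) :
    bornRule ρ x a = bornRule τ (fun i => x i) (fun i => a i) *
      bornRule σ (fun i => x i) (fun i => a i) := by
  have key : Matrix.trace (localTensor (fun i => (x i).povm.effect (a i)) * ρ) =
      Matrix.trace (localTensor (fun i : A => (x i).povm.effect (a i)) * τ) *
      Matrix.trace (localTensor
        (fun i : (Aᶜ : Finset (Fin N)) => (x i).povm.effect (a i)) * σ) := by
    simp only [Matrix.trace, Matrix.diag, Matrix.mul_apply]
    conv_rhs => rw [Finset.sum_mul_sum, ← Fintype.sum_prod_type', ← (splitEquiv d A).sum_comp]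
    refine Finset.sum_congr rfl fun s _ => ?_
    conv_rhs => rw [Finset.sum_mul_sum, ← Fintype.sum_prod_type', ← (splitEquiv d A).sum_comp]
    refine Finset.sum_congr rfl fun t _ => ?_
    simp only [localTensor, Matrix.of_apply, h, splitEquiv, Equiv.coe_fn_mk]
    rw [prod_eq_prod_mul_prod_compl A]
    ring
  have hre := Complex.le_def.1 (((jointPOVM fun i : A => x i).posSemidef
    (fun i => a i)).trace_mul_nonneg hτ.1)
  have him : (Matrix.trace (localTensor (fun i : A => (x i).povm.effect (a i)) * τ)).im = 0 :=
    hre.2.symm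
  rw [bornRule, key, Complex.mul_re, him, zero_mul, sub_zero]
  rfl

theorem hasLHSAcross_bornRule_of_product {d N : ℕ} (A : Finset (Fin N))
    {ρ : Matrix (Fin N → Fin d) (Fin N → Fin d) ℂ} {τ : Matrix (A → Fin d) (A → Fin d) ℂ}
    {σ : Matrix ((Aᶜ : Finset (Fin N)) → Fin d) ((Aᶜ : Finset (Fin N)) → Fin d) ℂ}
    (hτ : IsState τ) (hσ : IsState σ) (h : ∀ s t : Fin N → Fin d,
      ρ s t = τ (fun i => s i) (fun i => t i) * σ (fun i => s i) (fun i => t i)) :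
    HasLHSAcross A (bornRule ρ) :=
  ⟨Unit, inferInstance, Measure.dirac (), fun _ => bornRule τ, fun _ => σ, inferInstance,
    ⟨fun _ => bornRule_isStochastic hτ, fun _ _ => measurable_const⟩,
    ⟨fun _ => hσ, fun _ _ => measurable_const⟩,
    fun x a => by rw [integral_dirac, bornRule_product A hτ h]⟩

theorem isState_single {n : Type*} [Fintype n] [DecidableEq n] (i : n) :
    IsState (Matrix.diagonal (Pi.single i 1 : n → ℂ)) := by
  refine ⟨.diagonal fun j => ?_, by simp [Matrix.trace_diagonal]⟩
  by_cases h : j = i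
  · subst h; simp
  · simp [h]

theorem hasLHSAcross_nonempty {d N : ℕ} (hd : 0 < d) (A : Finset (Fin N)) :
    {q : Behaviour (Fin N) d | HasLHSAcross A q}.Nonempty :=
  ⟨_, hasLHSAcross_bornRule_of_product A (ρ := Matrix.of fun _ _ => _)
    (isState_single fun _ => ⟨0, hd⟩) (isState_single fun _ => ⟨0, hd⟩) fun _ _ => rfl⟩

theorem hybridLHS_iff {d N : ℕ} (hd : 0 < d) {p : Behaviour (Fin N) d} :
    HybridLHS p ↔ p ∈ convexHull ℝ (⋃ A ∈ directedBipartitions N,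
      {q : Behaviour (Fin N) d | HasLHSAcross A q}) := by
  rw [mem_convexHull_biUnion_iff (fun A _ => convex_hasLHSAcross A)
    fun A _ => hasLHSAcross_nonempty hd A]
  refine exists₂_congr fun w q => and_congr_right fun _ => and_congr_right fun _ =>
    ⟨fun h => Behaviour.ext fun x a => ?_, fun h x a => ?_⟩
  · rw [h, Behaviour.sum_apply]; rfl
  · rw [h, Behaviour.sum_apply]; rfl

/-- A hidden state is a particular hidden variable: a local hidden state model across `A | Aᶜ`
is a local hidden variable model. -/
theorem HasLHSAcross.hasLHVAcross {d N : ℕ} {A : Finset (Fin N)} {q : Behaviour (Fin N) d}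
    (h : HasLHSAcross A q) (P : Finpartition (Finset.univ : Finset (Fin N)))
    (hA : A ≠ Aᶜ) (hP : P.parts = {A, Aᶜ}) : HasLHVAcross P q := by
  obtain ⟨Λ, _, μ, R, σ, hμ, hR, hσ, hq⟩ := h
  let R' : (B : Finset (Fin N)) → Λ → Behaviour B d := Function.update
    (Function.update (fun _ _ _ _ => 0) A R) Aᶜ fun v => bornRule (σ v)
  have h1 : R' A = R := (Function.update_of_ne hA _ _).trans (Function.update_self ..)
  have h2 : R' Aᶜ = fun v => bornRule (σ v) := Function.update_self ..
  refine ⟨Λ, inferInstance, μ, R', hμ, ?_, fun x a => ?_⟩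
  · intro B hB
    rw [hP, Finset.mem_insert, Finset.mem_singleton] at hB
    rcases hB with rfl | rfl
    · rwa [h1]
    · rw [h2]; exact hσ.isResponse_bornRule
  · simp only [hq, hP, Finset.prod_pair hA, h1, h2]

/-- A bipartition consists of a directed bipartition and its complement. -/
theorem exists_directed_of_mem_bipartitions {N : ℕ}
    {P : Finpartition (Finset.univ : Finset (Fin N))} (hP : P ∈ bipartitions N) :
    ∃ A : Finset (Fin N), A ≠ Aᶜ ∧ P.parts = {A, Aᶜ} := by
  obtain ⟨A, B, hAB, h⟩ := Finset.card_eq_two.1 (Finset.mem_filter.1 hP).2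
  have hd : Disjoint A B := P.disjoint (by simp [h]) (by simp [h]) hAB
  have hu : A ∪ B = Finset.univ := by
    have := P.sup_parts
    rw [h, Finset.sup_insert, Finset.sup_singleton] at this
    simpa using this
  have hB : B = Aᶜ := by
    rw [← hd.symm.sdiff_eq_left, ← Finset.union_sdiff_left, hu, Finset.compl_eq_univ_sdiff]
  subst hB
  exact ⟨A, hAB, h⟩

theorem exists_mem_bipartitions_of_directed {N : ℕ} {A : Finset (Fin N)}
    (hA : A ∈ directedBipartitions N) :
    A ≠ Aᶜ ∧ ∃ P ∈ bipartitions N, P.parts = {A, Aᶜ} := by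
  obtain ⟨hne, huniv⟩ := (Finset.mem_filter.1 hA).2
  have h : A ≠ Aᶜ := fun h => by
    obtain ⟨i, hi⟩ := hne
    have := h ▸ hi
    exact Finset.mem_compl.1 this hi
  refine ⟨h, ⟨{A, Aᶜ}, ?_, ?_, ?_⟩, ?_, rfl⟩
  · rw [Finset.supIndep_pair h]
    exact disjoint_compl_right
  · rw [Finset.sup_insert, Finset.sup_singleton]
    simp
  · simp [hne.ne_empty.symm, eq_comm, huniv]
  · simp [bipartitions, Finset.card_pair h]

theorem hasLHVAcross_nonempty {d N : ℕ} (hd : 0 < d)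
    {P : Finpartition (Finset.univ : Finset (Fin N))} (hP : P ∈ bipartitions N) :
    {q : Behaviour (Fin N) d | HasLHVAcross P q}.Nonempty := by
  obtain ⟨A, hA, h⟩ := exists_directed_of_mem_bipartitions hP
  obtain ⟨q, hq⟩ := hasLHSAcross_nonempty hd A
  exact ⟨q, hq.hasLHVAcross P hA h⟩

theorem hybridLHV_iff {d N : ℕ} (hd : 0 < d) {p : Behaviour (Fin N) d} :
    HybridLHV p ↔ p ∈ convexHull ℝ (⋃ P ∈ bipartitions N,
      {q : Behaviour (Fin N) d | HasLHVAcross P q}) := by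
  rw [mem_convexHull_biUnion_iff (fun P _ => convex_hasLHVAcross P)
    fun P hP => hasLHVAcross_nonempty hd hP]
  refine exists₂_congr fun w q => and_congr_right fun _ => and_congr_right fun _ =>
    ⟨fun h => Behaviour.ext fun x a => ?_, fun h x a => ?_⟩
  · rw [h, Behaviour.sum_apply]; rfl
  · rw [h, Behaviour.sum_apply]; rfl

theorem HybridLHS.hybridLHV {d N : ℕ} (hd : 0 < d) {p : Behaviour (Fin N) d} (h : HybridLHS p) :
    HybridLHV p := by
  rw [hybridLHS_iff hd] at h
  rw [hybridLHV_iff hd]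
  refine convexHull_mono (fun q hq => ?_) h
  obtain ⟨A, hA, hq⟩ := Set.mem_iUnion₂.1 hq
  obtain ⟨hne, P, hP, hPA⟩ := exists_mem_bipartitions_of_directed hA
  exact Set.mem_iUnion₂.2 ⟨P, hP, hq.hasLHVAcross P hne hPA⟩

theorem HasLHSAcross.hybridLHS {d N : ℕ} (hd : 0 < d) {A : Finset (Fin N)}
    (hA : A ∈ directedBipartitions N) {p : Behaviour (Fin N) d} (h : HasLHSAcross A p) :
    HybridLHS p :=
  (hybridLHS_iff hd).2 (subset_convexHull ℝ _ (Set.mem_iUnion₂.2 ⟨A, hA, h⟩))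

/-! ### Product states -/

/-- Entrywise products of positive semidefinite matrices are positive semidefinite, by the Schur
product theorem. -/
theorem posSemidef_of_prod {κ n : Type*} [Fintype n] (s : Finset κ) {M : κ → Matrix n n ℂ}
    (hM : ∀ k ∈ s, (M k).PosSemidef) :
    (Matrix.of fun a b => ∏ k ∈ s, M k a b).PosSemidef := by
  classical
  induction s using Finset.induction_on with
  | empty =>
    convert Matrix.posSemidef_vecMulVec_self_star (1 : n → ℂ) using 1
    ext a b
    simp [Matrix.vecMulVec_apply]
  | insert k s hk ih =>
    have e : (Matrix.of fun a b => ∏ j ∈ insert k s, M j a b) =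
        (M k).hadamard (Matrix.of fun a b => ∏ j ∈ s, M j a b) := by
      ext a b
      simp [Finset.prod_insert hk]
    rw [e]
    exact (hM k (Finset.mem_insert_self k s)).hadamard
      (ih fun j hj => hM j (Finset.mem_insert_of_mem hj))

/-- Summing over all tuples amounts to summing over the tuples of each block independently. -/
theorem sum_prod_parts {d N : ℕ} (P : Finpartition (Finset.univ : Finset (Fin N)))
    (f : (B : Finset (Fin N)) → (B → Fin d) → ℂ) :
    ∑ s : Fin N → Fin d, ∏ B ∈ P.parts, f B (fun i => s i) = ∏ B ∈ P.parts, ∑ u, f B u := by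
  rw [← Finset.prod_coe_sort P.parts fun B => ∑ u, f B u, Finset.prod_univ_sum,
    Fintype.piFinset_univ]
  let F : (Fin N → Fin d) → ((B : P.parts) → (B.1 → Fin d)) := fun s B i => s i
  have hF : Function.Bijective F := by
    constructor
    · intro s t hst
      ext i
      obtain ⟨B, hB, hi⟩ := P.exists_mem (Finset.mem_univ i)
      exact congrArg Fin.val (congrFun (congrFun hst ⟨B, hB⟩) ⟨i, hi⟩)
    · intro p
      refine ⟨fun i => p ⟨P.part i, P.part_mem.2 (Finset.mem_univ i)⟩
        ⟨i, P.mem_part (Finset.mem_univ i)⟩, ?_⟩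
      funext ⟨B, hB⟩ ⟨i, hi⟩
      obtain rfl : P.part i = B := P.part_eq_of_mem hB hi
      rfl
  rw [← hF.sum_comp]
  refine Finset.sum_congr rfl fun s _ => ?_
  rw [← Finset.prod_coe_sort]

/-- A product state with respect to a partition into at least two blocks is a product across
`A | Aᶜ`, where `A` is any of the blocks. -/
theorem IsProductState.exists_split {d N : ℕ} {P : Finpartition (Finset.univ : Finset (Fin N))}
    {ρ : Matrix (Fin N → Fin d) (Fin N → Fin d) ℂ} (hP : 2 ≤ P.parts.card)
    (h : IsProductState P ρ) :
    ∃ A ∈ directedBipartitions N, ∃ (τ : Matrix (A → Fin d) (A → Fin d) ℂ)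
      (σ : Matrix ((Aᶜ : Finset (Fin N)) → Fin d) ((Aᶜ : Finset (Fin N)) → Fin d) ℂ),
      IsState τ ∧ IsState σ ∧ ∀ s t : Fin N → Fin d,
        ρ s t = τ (fun i => s i) (fun i => t i) * σ (fun i => s i) (fun i => t i) := by
  obtain ⟨τ, hτ, rfl⟩ := h
  obtain ⟨A, hA⟩ : P.parts.Nonempty := Finset.card_pos.1 (by omega)
  have huniv : A ≠ Finset.univ := by
    rintro rfl
    obtain ⟨B, hB, hne⟩ := Finset.exists_mem_ne (by omega : 1 < P.parts.card) Finset.univ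
    obtain ⟨i, hi⟩ := P.nonempty_of_mem_parts hB
    exact Finset.disjoint_left.1 (P.disjoint hB hA hne) hi (Finset.mem_univ i)
  -- A fixed tuple `r` on `A` extends the tuples on `Aᶜ` to all parties, so that they can be restricted
  -- to the other blocks.
  obtain ⟨r⟩ := (hτ A hA).nonempty
  let e : ((Aᶜ : Finset (Fin N)) → Fin d) → Fin N → Fin d := fun s => (splitEquiv d A).symm (r, s)
  let σ : Matrix ((Aᶜ : Finset (Fin N)) → Fin d) ((Aᶜ : Finset (Fin N)) → Fin d) ℂ :=
    Matrix.of fun s t => ∏ B ∈ P.parts.erase A, τ B (fun i => e s i) (fun i => e t i)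
  have hσ : σ.PosSemidef :=
    posSemidef_of_prod (M := fun B => (τ B).submatrix (fun s i => e s i) (fun s i => e s i)) _
      fun B hB => (hτ B (Finset.mem_of_mem_erase hB)).1.submatrix _
  have hprod : ∀ s t : Fin N → Fin d, ∏ B ∈ P.parts, τ B (fun i => s i) (fun i => t i) =
      τ A (fun i => s i) (fun i => t i) * σ (fun i => s i) (fun i => t i) := by
    intro s t
    rw [← Finset.mul_prod_erase _ _ hA]
    simp only [σ, Matrix.of_apply]
    congr 1
    refine Finset.prod_congr rfl fun B hB => ?_
    have hdisj := P.disjoint (Finset.mem_of_mem_erase hB) hA (Finset.ne_of_mem_erase hB)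
    have hmem : ∀ i : B, (i : Fin N) ∉ A := fun i => Finset.disjoint_left.1 hdisj i.2
    congr 1
    · exact funext fun i => (splitEquiv_symm_apply_of_notMem r s (hmem i)).symm
    · exact funext fun i => (splitEquiv_symm_apply_of_notMem r t (hmem i)).symm
  have htr : (τ A).trace * σ.trace = 1 := by
    have h1 := (sum_prod_parts (d := d) P fun B u => τ B u u).trans
      (Finset.prod_eq_one fun B hB => (hτ B hB).2)
    rw [← h1, Matrix.trace, Matrix.trace, Finset.sum_mul_sum, ← Fintype.sum_prod_type',
      ← (splitEquiv d A).sum_comp]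
    exact Finset.sum_congr rfl fun s _ => (hprod s s).symm
  refine ⟨A, ?_, τ A, σ, hτ A hA, ⟨hσ, ?_⟩, hprod⟩
  · simp [directedBipartitions, P.nonempty_of_mem_parts hA, huniv]
  · rwa [(hτ A hA).2, one_mul] at htr

theorem HybridSeparable.hybridLHS {d N : ℕ} (hd : 0 < d)
    {ρ : Matrix (Fin N → Fin d) (Fin N → Fin d) ℂ} (h : HybridSeparable ρ) :
    HybridLHS (bornRule ρ) := by
  rw [hybridLHS_iff hd]
  have h1 := Set.mem_image_of_mem (bornRuleLinear (Fin N) d) h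
  rw [LinearMap.image_convexHull] at h1
  refine convexHull_mono ?_ h1
  rintro _ ⟨σ, ⟨P, hP, hσ⟩, rfl⟩
  obtain ⟨A, hA, τ, σ', hτ, hσ', h⟩ := hσ.exists_split hP
  exact Set.mem_iUnion₂.2 ⟨A, hA, hasLHSAcross_bornRule_of_product A hτ hσ' h⟩

theorem GMNL_subset_GMS {d : ℕ} (hd : 0 < d) (N : ℕ) : GMNL d N ⊆ GMS d N :=
  fun _ h => ⟨h.1, fun h' => h.2 (h'.hybridLHV hd)⟩

theorem GMS_subset_GME {d : ℕ} (hd : 0 < d) (N : ℕ) : GMS d N ⊆ GME d N :=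
  fun _ h => ⟨h.1, fun h' => h.2 (h'.hybridLHS hd)⟩

/-! ### Local hidden state models of lifted states and of groups of parties -/

/-- Renaming the outcomes of a POVM. -/
def POVM.relabel {n O O' : Type*} [Fintype n] [DecidableEq n] [Fintype O] [Fintype O']
    (E : POVM n O) (e : O ≃ O') : POVM n O' where
  effect a := E.effect (e.symm a)
  posSemidef _ := E.posSemidef _
  sum_eq_one := by rw [e.symm.sum_comp E.effect, E.sum_eq_one]

/-- The POVM with effects `Vᴴ E_a V`, for an isometry `V`. -/
def POVM.compress {m n O : Type*} [Fintype m] [DecidableEq m] [Fintype n] [DecidableEq n]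
    [Fintype O] (E : POVM m O) (V : Matrix m n ℂ) (hV : V.conjTranspose * V = 1) : POVM n O where
  effect a := V.conjTranspose * E.effect a * V
  posSemidef a := (E.posSemidef a).conjTranspose_mul_mul_same V
  sum_eq_one := by rw [← Matrix.sum_mul, ← Matrix.mul_sum, E.sum_eq_one, Matrix.mul_one, hV]

theorem IsState.conjugate {m n : Type*} [Fintype m] [Fintype n] [DecidableEq n]
    {ρ : Matrix n n ℂ} (hρ : IsState ρ) {V : Matrix m n ℂ} (hV : V.conjTranspose * V = 1) :
    IsState (V * ρ * V.conjTranspose) :=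
  ⟨hρ.1.mul_mul_conjTranspose_same V, by
    rw [Matrix.trace_mul_comm, ← Matrix.mul_assoc, hV, Matrix.one_mul, hρ.2]⟩

/-- Local isometries preserve the existence of a local hidden state model: they can be absorbed
into the measurements of the first side and into the hidden states of the second. -/
theorem HasLHSModel.conjugate {m n m' n' : Type*} [Fintype m] [DecidableEq m] [Fintype n]
    [DecidableEq n] [Fintype m'] [DecidableEq m'] [Fintype n'] [DecidableEq n']
    {ρ : Matrix (m × n) (m × n) ℂ} (h : HasLHSModel ρ) {V : Matrix m' m ℂ} {W : Matrix n' n ℂ}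
    (hV : V.conjTranspose * V = 1) (hW : W.conjTranspose * W = 1) :
    HasLHSModel ((V ⊗ₖ W) * ρ * (V ⊗ₖ W).conjTranspose) := by
  obtain ⟨Λ, _, μ, R, σ, hμ, hR, hRm, hσ, h⟩ := h
  refine ⟨Λ, inferInstance, μ, fun v o E => R v o (E.compress V hV),
    fun v => W * σ v * W.conjTranspose, hμ, fun v o E => hR v o _, fun o E => hRm o _,
    ⟨fun v => (hσ.1 v).conjugate hW, fun s t => ?_⟩, fun o o' E F a b => ?_⟩
  · have := hσ.2
    simp only [Matrix.mul_apply]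
    fun_prop
  · have e1 : Matrix.trace ((E.effect a ⊗ₖ F.effect b) *
        ((V ⊗ₖ W) * ρ * (V ⊗ₖ W).conjTranspose)) =
        Matrix.trace (((E.compress V hV).effect a ⊗ₖ (F.compress W hW).effect b) * ρ) := by
      simp only [POVM.compress, Matrix.mul_kronecker_mul, ← Matrix.conjTranspose_kronecker]
      rw [← Matrix.mul_assoc, Matrix.trace_mul_comm]
      simp only [Matrix.mul_assoc]
    have e2 : ∀ v, Matrix.trace (F.effect b * (W * σ v * W.conjTranspose)) =
        Matrix.trace ((F.compress W hW).effect b * σ v) := by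
      intro v
      simp only [POVM.compress]
      rw [← Matrix.mul_assoc, Matrix.trace_mul_comm]
      simp only [Matrix.mul_assoc]
    rw [e1, h]
    simp only [e2]

theorem repIsometry_isometry {d k : ℕ} (hk : 1 ≤ k) :
    (repIsometry d k).conjTranspose * repIsometry d k = 1 := by
  ext i j
  simp only [Matrix.mul_apply, Matrix.conjTranspose_apply, repIsometry, Matrix.of_apply,
    Matrix.one_apply, apply_ite star, star_one, star_zero, ite_mul, one_mul, zero_mul,
    Finset.sum_ite_eq', Finset.mem_univ, if_true]
  exact if_congr ⟨fun h => congrFun h ⟨0, hk⟩, fun h => h ▸ rfl⟩ rfl rfl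

/-- The first `k` of `k + l` parties. -/
def firstParties (k l : ℕ) : Finset (Fin (k + l)) := Finset.univ.filter fun i => (i : ℕ) < k

/-- The numbering of the first `k` parties. -/
def firstPartiesEquiv (k l : ℕ) : Fin k ≃ firstParties k l where
  toFun i := ⟨Fin.castAdd l i, by simp [firstParties]⟩
  invFun i := ⟨i.1, (Finset.mem_filter.1 i.2).2⟩
  left_inv i := rfl
  right_inv i := rfl

/-- The numbering of the last `l` parties. -/
def lastPartiesEquiv (k l : ℕ) : Fin l ≃ ((firstParties k l)ᶜ : Finset (Fin (k + l))) where
  toFun i := ⟨Fin.natAdd k i, by simp [firstParties]⟩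
  invFun i := ⟨i.1 - k, by
    have := i.2
    simp only [firstParties, Finset.mem_compl, Finset.mem_filter, Finset.mem_univ, true_and] at this
    omega⟩
  left_inv i := by ext; simp
  right_inv i := by
    have := i.2
    simp only [firstParties, Finset.mem_compl, Finset.mem_filter, Finset.mem_univ, true_and] at this
    ext; simp; omega

theorem firstParties_mem_directedBipartitions {k l : ℕ} (hk : 1 ≤ k) (hl : 1 ≤ l) :
    firstParties k l ∈ directedBipartitions (k + l) := by
  simp only [directedBipartitions, Finset.mem_filter, Finset.mem_univ, true_and]
  refine ⟨⟨(firstPartiesEquiv k l ⟨0, hk⟩).1, (firstPartiesEquiv k l ⟨0, hk⟩).2⟩, fun h => ?_⟩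
  have hmem : ∀ i, i ∈ firstParties k l := fun i => h ▸ Finset.mem_univ i
  exact Finset.mem_compl.1 (lastPartiesEquiv k l ⟨0, hl⟩).2 (hmem _)

/-- Renaming the parties of a POVM of a group of parties. -/
def POVM.reindexParties {ι κ O : Type*} [Fintype ι] [DecidableEq ι] [Fintype κ] [DecidableEq κ]
    [Fintype O] {d : ℕ} (E : POVM (κ → Fin d) O) (e : ι ≃ κ) : POVM (ι → Fin d) O where
  effect a := (E.effect a).submatrix (fun s => s ∘ e.symm) (fun s => s ∘ e.symm)
  posSemidef a := (E.posSemidef a).submatrix _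
  sum_eq_one := by
    ext s t
    simp only [Matrix.sum_apply, Matrix.submatrix_apply]
    rw [← Matrix.sum_apply, E.sum_eq_one, Matrix.one_apply, Matrix.one_apply]
    simp only [e.symm.surjective.injective_comp_right.eq_iff]

theorem localTensor_submatrix_comp {ι κ : Type*} [Fintype ι] [Fintype κ] {d : ℕ}
    (M : κ → Matrix (Fin d) (Fin d) ℂ) (e : ι ≃ κ) :
    (localTensor M).submatrix (fun s => s ∘ e.symm) (fun s => s ∘ e.symm) =
      localTensor fun i => M (e i) := by
  ext s t
  simp only [localTensor, Matrix.submatrix_apply, Matrix.of_apply]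
  rw [← e.prod_comp]
  simp

theorem trace_localTensor_mul_toParties {d k l : ℕ}
    (M : Fin (k + l) → Matrix (Fin d) (Fin d) ℂ)
    (ρ : Matrix ((Fin k → Fin d) × (Fin l → Fin d)) ((Fin k → Fin d) × (Fin l → Fin d)) ℂ) :
    Matrix.trace (localTensor M * toParties ρ) =
      Matrix.trace ((localTensor (fun i : Fin k => M (Fin.castAdd l i)) ⊗ₖ
        localTensor (fun i : Fin l => M (Fin.natAdd k i))) * ρ) := by
  simp only [Matrix.trace, Matrix.diag, Matrix.mul_apply]
  rw [← (Fin.appendEquiv k l).sum_comp]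
  refine Finset.sum_congr rfl fun s _ => ?_
  rw [← (Fin.appendEquiv k l).sum_comp]
  refine Finset.sum_congr rfl fun t _ => ?_
  simp [localTensor, toParties, Fin.prod_univ_add, Fin.appendEquiv]

/-- Local measurements of the parties of a group are among the POVMs of the group, so that a
bipartite local hidden state model is one across the corresponding groups of parties. -/
theorem HasLHSModel.hasLHSAcross {d k l : ℕ}
    {ρ : Matrix ((Fin k → Fin d) × (Fin l → Fin d)) ((Fin k → Fin d) × (Fin l → Fin d)) ℂ}
    (h : HasLHSModel ρ) : HasLHSAcross (firstParties k l) (bornRule (toParties ρ)) := by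
  classical
  obtain ⟨Λ, _, μ, R, σ, hμ, hR, hRm, hσ, h⟩ := h
  let E : (x : firstParties k l → Setting d) →
      POVM (Fin k → Fin d) (Fin (Fintype.card ((i : firstParties k l) → Fin (x i).outcomes))) :=
    fun x => ((jointPOVM x).reindexParties (firstPartiesEquiv k l)).relabel (Fintype.equivFin _)
  let F : (x : ((firstParties k l)ᶜ : Finset (Fin (k + l))) → Setting d) →
      POVM (Fin l → Fin d) (Fin (Fintype.card
        ((i : ((firstParties k l)ᶜ : Finset (Fin (k + l)))) → Fin (x i).outcomes))) :=
    fun x => ((jointPOVM x).reindexParties (lastPartiesEquiv k l)).relabel (Fintype.equivFin _)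
  refine ⟨Λ, inferInstance, μ, fun v x a => R v _ (E x) (Fintype.equivFin _ a),
    fun v => (σ v).submatrix (fun s => s ∘ lastPartiesEquiv k l)
      (fun s => s ∘ lastPartiesEquiv k l), hμ,
    ⟨fun v x => ⟨fun a => (hR v _ _).1 _, ?_⟩, fun x a => hRm _ _ _⟩,
    ⟨fun v => ⟨(hσ.1 v).1.submatrix _, ?_⟩, fun s t => hσ.2 _ _⟩, fun x a => ?_⟩
  · rw [(Fintype.equivFin _).sum_comp fun b => R v _ (E x) b]
    exact (hR v _ _).2
  · rw [← (hσ.1 v).2]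
    exact (Equiv.arrowCongr (lastPartiesEquiv k l).symm (Equiv.refl (Fin d))).sum_comp
      fun s => σ v s s
  · have h1 := h _ _ (E fun i => x i) (F fun i => x i) (Fintype.equivFin _ fun i => a i)
      (Fintype.equivFin _ fun i => a i)
    have eE : (E fun i => x i).effect (Fintype.equivFin _ fun i => a i) =
        localTensor fun i : Fin k => (x (Fin.castAdd l i)).povm.effect (a (Fin.castAdd l i)) := by
      simp only [E, POVM.relabel, Equiv.symm_apply_apply, POVM.reindexParties, jointPOVM,
        localTensor_submatrix_comp]
      rfl
    have eF : (F fun i => x i).effect (Fintype.equivFin _ fun i => a i) =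
        localTensor fun i : Fin l => (x (Fin.natAdd k i)).povm.effect (a (Fin.natAdd k i)) := by
      simp only [F, POVM.relabel, Equiv.symm_apply_apply, POVM.reindexParties, jointPOVM,
        localTensor_submatrix_comp]
      rfl
    rw [bornRule, trace_localTensor_mul_toParties, ← eE, ← eF, h1]
    refine integral_congr_ae (.of_forall fun v => ?_)
    dsimp only
    congr 2
    rw [eF]
    simp only [Matrix.trace, Matrix.diag, Matrix.mul_apply]
    rw [← (Equiv.arrowCongr (lastPartiesEquiv k l).symm (Equiv.refl (Fin d))).sum_comp]
    refine Finset.sum_congr rfl fun s _ => ?_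
    rw [← (Equiv.arrowCongr (lastPartiesEquiv k l).symm (Equiv.refl (Fin d))).sum_comp]
    refine Finset.sum_congr rfl fun t _ => ?_
    simp only [localTensor, Matrix.of_apply, Matrix.submatrix_apply]
    congr 1
    rw [← (lastPartiesEquiv k l).prod_comp]
    rfl

/-! ### Werner states -/

theorem swapOp_mul_self (d : ℕ) : swapOp d * swapOp d = 1 := by
  ext p q
  simp only [swapOp, Matrix.mul_apply, Matrix.of_apply, Fintype.sum_prod_type, Matrix.one_apply,
    ite_and, mul_ite, mul_one, mul_zero]
  simp [Prod.ext_iff, ite_and]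

theorem swapOp_isHermitian (d : ℕ) : (swapOp d).conjTranspose = swapOp d := by
  ext p q
  simp only [swapOp, Matrix.conjTranspose_apply, Matrix.of_apply, apply_ite star, star_one,
    star_zero]
  exact if_congr (by constructor <;> rintro ⟨h1, h2⟩ <;> exact ⟨h2.symm, h1.symm⟩) rfl rfl

theorem antisymProj_posSemidef (d : ℕ) : (antisymProj d).PosSemidef := by
  have h : antisymProj d = (antisymProj d).conjTranspose * antisymProj d := by
    have hF := swapOp_mul_self d
    simp only [antisymProj, Matrix.conjTranspose_smul, Matrix.conjTranspose_sub,
      Matrix.conjTranspose_one, swapOp_isHermitian, Matrix.smul_mul, Matrix.mul_smul,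
      Matrix.sub_mul, Matrix.mul_sub, hF, Matrix.one_mul, Matrix.mul_one]
    ext p q
    simp
    ring
  rw [h]
  exact Matrix.posSemidef_conjTranspose_mul_self _

theorem trace_kronecker_mul_swapOp {d : ℕ} (E F : Matrix (Fin d) (Fin d) ℂ) :
    Matrix.trace ((E ⊗ₖ F) * swapOp d) = Matrix.trace (E * F) := by
  simp only [Matrix.trace, Matrix.diag, Matrix.mul_apply, swapOp, Matrix.of_apply,
    Fintype.sum_prod_type, ite_and, mul_ite, mul_one, mul_zero, Matrix.kroneckerMap_apply]
  simp

/-- The statistics of product effects on the Werner state. -/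
theorem trace_kronecker_mul_werner {d : ℕ} (η : ℝ) (E F : Matrix (Fin d) (Fin d) ℂ) :
    Matrix.trace ((E ⊗ₖ F) * werner d η) =
      η / (d * (d - 1)) * (E.trace * F.trace - (E * F).trace) +
        (1 - η) / d ^ 2 * (E.trace * F.trace) := by
  simp only [werner, antisymProj, Matrix.mul_add, Matrix.mul_smul, Matrix.mul_sub, Matrix.mul_one,
    Matrix.trace_add, Matrix.trace_smul, Matrix.trace_sub, Matrix.trace_kronecker,
    trace_kronecker_mul_swapOp, smul_eq_mul]
  ring

theorem werner_isState {d : ℕ} (hd : 2 ≤ d) {η : ℝ} (h0 : 0 ≤ η) (h1 : η ≤ 1) :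
    IsState (werner d η) := by
  have hd' : (2 : ℝ) ≤ d := by exact_mod_cast hd
  have hd0 : (d : ℂ) ≠ 0 := by exact_mod_cast (by omega : d ≠ 0)
  have hd1 : (d : ℂ) - 1 ≠ 0 := sub_ne_zero.2 (by exact_mod_cast (by omega : d ≠ 1))
  constructor
  · refine ((antisymProj_posSemidef d).smul ?_).add (Matrix.PosSemidef.one.smul ?_)
    · have : (η : ℂ) * (2 / ((d : ℂ) * ((d : ℂ) - 1))) =
          ((η * (2 / ((d : ℝ) * ((d : ℝ) - 1))) : ℝ) : ℂ) := by push_cast; rfl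
      rw [this, Complex.zero_le_real]
      have : 0 ≤ (d : ℝ) - 1 := by linarith
      positivity
    · have : (1 - (η : ℂ)) / (d : ℂ) ^ 2 = (((1 - η) / (d : ℝ) ^ 2 : ℝ) : ℂ) := by push_cast; rfl
      rw [this, Complex.zero_le_real]
      have : 0 ≤ 1 - η := by linarith
      positivity
  · have := trace_kronecker_mul_werner η (1 : Matrix (Fin d) (Fin d) ℂ) 1
    rw [Matrix.one_kronecker_one, Matrix.one_mul, Matrix.one_mul, Matrix.trace_one,
      Fintype.card_fin] at this
    rw [this]
    field_simp
    ring

/-! ### Entanglement of the lifted Werner states -/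

/-- The string `i … i j … j` with `k` entries `i` and `l` entries `j`. -/
def twoBlockString (k l : ℕ) {d : ℕ} (p : Fin d × Fin d) : Fin (k + l) → Fin d :=
  Fin.append (fun _ => p.1) fun _ => p.2

theorem twoBlockString_apply {k l d : ℕ} (p : Fin d × Fin d) (z : Fin (k + l)) :
    twoBlockString k l p z = if (z : ℕ) < k then p.1 else p.2 := by
  refine Fin.addCases (fun i => ?_) (fun i => ?_) z <;> simp [twoBlockString]

/-- The isometry `V_k ⊗ V_l`, with its range seen as strings of `k + l` letters. -/
def liftIsometry (d k l : ℕ) : Matrix (Fin (k + l) → Fin d) (Fin d × Fin d) ℂ :=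
  (repIsometry d k ⊗ₖ repIsometry d l).submatrix (Fin.appendEquiv k l).symm id

theorem toParties_liftedWerner (d k l : ℕ) (η : ℝ) :
    toParties (liftedWerner d k l η) =
      liftIsometry d k l * werner d η * (liftIsometry d k l).conjTranspose := by
  ext s t
  rfl

theorem liftIsometry_apply {d k l : ℕ} (s : Fin (k + l) → Fin d) (p : Fin d × Fin d) :
    liftIsometry d k l s p = if s = twoBlockString k l p then 1 else 0 := by
  obtain ⟨⟨s, t⟩, rfl⟩ := (Fin.appendEquiv k l).surjective s
  have : (Fin.appendEquiv k l) (s, t) = twoBlockString k l p ↔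
      s = (fun _ => p.1) ∧ t = fun _ => p.2 := by
    rw [← Prod.mk.injEq, ← (Fin.appendEquiv k l).apply_eq_iff_eq (x := (s, t))]
    rfl
  simp only [this, liftIsometry, Matrix.submatrix_apply, Equiv.symm_apply_apply, id,
    Matrix.kroneckerMap_apply, repIsometry, Matrix.of_apply, ite_and]
  split_ifs <;> simp

theorem twoBlockString_injective {d k l : ℕ} (hk : 1 ≤ k) (hl : 1 ≤ l) :
    Function.Injective (twoBlockString k l (d := d)) := by
  intro p q h
  have h1 := congrFun h (Fin.castAdd l ⟨0, hk⟩)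
  have h2 := congrFun h (Fin.natAdd k ⟨0, hl⟩)
  simp only [twoBlockString, Fin.append_left, Fin.append_right] at h1 h2
  exact Prod.ext h1 h2

theorem liftIsometry_isometry {d k l : ℕ} (hk : 1 ≤ k) (hl : 1 ≤ l) :
    (liftIsometry d k l).conjTranspose * liftIsometry d k l = 1 := by
  ext p q
  simp [Matrix.mul_apply, Matrix.conjTranspose_apply, liftIsometry_apply, Matrix.one_apply,
    (twoBlockString_injective hk hl).eq_iff, eq_comm]

theorem lift_submatrix {d k l : ℕ} (hk : 1 ≤ k) (hl : 1 ≤ l)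
    (M : Matrix (Fin d × Fin d) (Fin d × Fin d) ℂ) (p q : Fin d × Fin d) :
    (liftIsometry d k l * M * (liftIsometry d k l).conjTranspose) (twoBlockString k l p)
      (twoBlockString k l q) = M p q := by
  simp [Matrix.mul_apply, Matrix.conjTranspose_apply, liftIsometry_apply,
    (twoBlockString_injective hk hl).eq_iff]

theorem lift_diag_eq_zero {d k l : ℕ} (M : Matrix (Fin d × Fin d) (Fin d × Fin d) ℂ)
    {s : Fin (k + l) → Fin d} (hs : ∀ p, s ≠ twoBlockString k l p) :
    (liftIsometry d k l * M * (liftIsometry d k l).conjTranspose) s s = 0 := by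
  simp [Matrix.mul_apply, Matrix.conjTranspose_apply, liftIsometry_apply, hs]

/-- The expectation value of the swap operator in the span of the two-block strings. -/
def swapWitness {d k l : ℕ} (ρ : Matrix (Fin (k + l) → Fin d) (Fin (k + l) → Fin d) ℂ) : ℝ :=
  ∑ i, ∑ j, (ρ (twoBlockString k l (j, i)) (twoBlockString k l (i, j))).re

theorem swapWitness_liftedWerner {d k l : ℕ} (hd : 2 ≤ d) (hk : 1 ≤ k) (hl : 1 ≤ l) (η : ℝ) :
    swapWitness (toParties (liftedWerner d k l η)) = (1 - η) / d - η := by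
  have hd0 : (d : ℝ) ≠ 0 := by exact_mod_cast (by omega : d ≠ 0)
  have hd1 : (d : ℝ) - 1 ≠ 0 := sub_ne_zero.2 (by exact_mod_cast (by omega : d ≠ 1))
  have h : ∀ i j : Fin d, werner d η (j, i) (i, j) =
      ((η / (d * (d - 1)) * ((if j = i then 1 else 0) - 1) +
        (1 - η) / d ^ 2 * (if j = i then 1 else 0) : ℝ) : ℂ) := by
    intro i j
    by_cases hij : j = i
    · subst hij
      simp [werner, antisymProj, swapOp]
    · simp [werner, antisymProj, swapOp, hij]
      ring
  simp only [swapWitness, toParties_liftedWerner, lift_submatrix hk hl, h, Complex.ofReal_re]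
  simp [Finset.sum_add_distrib, ← Finset.mul_sum, Finset.sum_sub_distrib]
  field_simp
  ring

/-- If a diagonal entry of a positive semidefinite matrix vanishes, so does its column. -/
theorem Matrix.PosSemidef.apply_eq_zero_of_diag {n : Type*} [Fintype n] {A : Matrix n n ℂ}
    (hA : A.PosSemidef) {i : n} (h : A i i = 0) (j : n) : A j i = 0 := by
  classical
  have := (Matrix.PosSemidef.dotProduct_mulVec_zero_iff hA (Pi.single i 1)).1 (by simp [h])
  simpa using congrFun this j

/-- A product across `A | Aᶜ` that is supported on the two-block strings has a nonnegative swap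
expectation value. If `A` is one of the two blocks, the value is the trace of a product of two
positive operators. If `A` splits one of the blocks, exchanging the letters on `A` alone leads out
of the support, so that the off-diagonal terms vanish. -/
theorem swapWitness_nonneg_of_product {d k l : ℕ} {A : Finset (Fin (k + l))}
    (hA : A ∈ directedBipartitions (k + l))
    {ρ : Matrix (Fin (k + l) → Fin d) (Fin (k + l) → Fin d) ℂ}
    {τ : Matrix (A → Fin d) (A → Fin d) ℂ}
    {σ : Matrix ((Aᶜ : Finset (Fin (k + l))) → Fin d) ((Aᶜ : Finset (Fin (k + l))) → Fin d) ℂ}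
    (hτ : τ.PosSemidef) (hσ : σ.PosSemidef) (h : ∀ s t : Fin (k + l) → Fin d,
      ρ s t = τ (fun i => s i) (fun i => t i) * σ (fun i => s i) (fun i => t i))
    (hsupp : ∀ s, (∀ p, s ≠ twoBlockString k l p) → ρ s s = 0) : 0 ≤ swapWitness ρ := by
  obtain ⟨⟨x₀, hx₀⟩, huniv⟩ := (Finset.mem_filter.1 hA).2
  obtain ⟨y₀, hy₀⟩ : ∃ y, y ∉ A := by
    by_contra! hc
    exact huniv (Finset.eq_univ_iff_forall.2 hc)
  by_cases hcut : ∃ x ∈ A, ∃ y ∉ A, ((x : ℕ) < k ↔ (y : ℕ) < k)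
  · obtain ⟨x, hx, y, hy, hxy⟩ := hcut
    refine Finset.sum_nonneg fun i _ => Finset.sum_nonneg fun j _ => ?_
    by_cases hij : i = j
    · subst hij
      rw [h]
      have h1 := hτ.diag_nonneg (i := fun z : A => twoBlockString k l (i, i) z)
      have h2 := hσ.diag_nonneg
        (i := fun z : (Aᶜ : Finset (Fin (k + l))) => twoBlockString k l (i, i) z)
      exact (Complex.le_def.1 (mul_nonneg h1 h2)).1
    · -- The letters of one string on `A`, those of the swapped string on `Aᶜ`.
      let m : Fin (k + l) → Fin d := fun z =>
        if z ∈ A then twoBlockString k l (i, j) z else twoBlockString k l (j, i) z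
      have hm : ∀ p, m ≠ twoBlockString k l p := by
        intro p hp
        have h1 := congrFun hp x
        have h2 := congrFun hp y
        simp only [m, hx, hy, if_true, if_false, twoBlockString_apply, hxy] at h1 h2
        split_ifs at h1 h2
        · exact hij (h1.trans h2.symm)
        · exact hij (h2.trans h1.symm)
      have h0 := hsupp m hm
      have e1 : (fun z : A => m z) = fun z : A => twoBlockString k l (i, j) z :=
        funext fun z => if_pos z.2
      have e2 : (fun z : (Aᶜ : Finset (Fin (k + l))) => m z) =
          fun z : (Aᶜ : Finset (Fin (k + l))) => twoBlockString k l (j, i) z :=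
        funext fun z => if_neg (Finset.mem_compl.1 z.2)
      rw [h, e1, e2] at h0
      rw [h]
      rcases mul_eq_zero.1 h0 with h0 | h0
      · rw [hτ.apply_eq_zero_of_diag h0]; simp
      · rw [← hσ.1.apply, hσ.apply_eq_zero_of_diag h0]; simp
  · push Not at hcut
    -- `A` is one of the two blocks, so that `τ` and `σ` see one letter each.
    have key : ∀ (a : Fin d → A → Fin d) (c : Fin d → (Aᶜ : Finset (Fin (k + l))) → Fin d),
        0 ≤ ∑ i, ∑ j, (τ (a j) (a i) * σ (c i) (c j)).re := by
      intro a c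
      have := (hτ.submatrix a).trace_mul_nonneg (hσ.submatrix c)
      simp only [Matrix.trace, Matrix.diag, Matrix.mul_apply, Matrix.submatrix_apply] at this
      have h1 := (Complex.le_def.1 this).1
      rw [Finset.sum_comm]
      simpa only [Complex.re_sum, Complex.zero_re] using h1
    have h0 := hcut x₀ hx₀ y₀ hy₀
    by_cases hx : (x₀ : ℕ) < k
    · have hy : ¬ (y₀ : ℕ) < k := by omega
      have hall : ∀ z : A, ((z : Fin (k + l)) : ℕ) < k := fun z => by
        have := hcut z z.2 y₀ hy₀; omega
      have hall' : ∀ z : (Aᶜ : Finset (Fin (k + l))), ¬ ((z : Fin (k + l)) : ℕ) < k := fun z => by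
        have := hcut x₀ hx₀ z (Finset.mem_compl.1 z.2); omega
      convert key (fun i _ => i) (fun i _ => i) using 1
      simp only [swapWitness, h, twoBlockString_apply, hall, hall', if_true, if_false]
    · have hy : (y₀ : ℕ) < k := by omega
      have hall : ∀ z : A, ¬ ((z : Fin (k + l)) : ℕ) < k := fun z => by
        have := hcut z z.2 y₀ hy₀; omega
      have hall' : ∀ z : (Aᶜ : Finset (Fin (k + l))), ((z : Fin (k + l)) : ℕ) < k := fun z => by
        have := hcut x₀ hx₀ z (Finset.mem_compl.1 z.2); omega
      convert key (fun i _ => i) (fun i _ => i) using 1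
      simp only [swapWitness, h, twoBlockString_apply, hall, hall', if_true, if_false]
      exact Finset.sum_comm

/-- The swap operator detects entanglement on the two-block strings. -/
theorem HybridSeparable.swapWitness_nonneg {d k l : ℕ}
    {ρ : Matrix (Fin (k + l) → Fin d) (Fin (k + l) → Fin d) ℂ} (h : HybridSeparable ρ)
    (hsupp : ∀ s, (∀ p, s ≠ twoBlockString k l p) → ρ s s = 0) : 0 ≤ swapWitness ρ := by
  -- Positivity of the diagonal makes the support condition pass to the terms of a mixture.
  have hT : Convex ℝ {ρ : Matrix (Fin (k + l) → Fin d) (Fin (k + l) → Fin d) ℂ |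
      (∀ s, 0 ≤ ρ s s) ∧
        ((∀ s, (∀ p, s ≠ twoBlockString k l p) → ρ s s = 0) → 0 ≤ swapWitness ρ)} := by
    refine convex_iff_forall_pos.2 ?_
    rintro ρ ⟨hρ, hρ'⟩ ρ' ⟨h₂, h₂'⟩ a b ha hb -
    have hnn : ∀ {c : ℝ} {z : ℂ}, 0 < c → 0 ≤ z → 0 ≤ (c : ℂ) * z := fun hc hz =>
      mul_nonneg (Complex.zero_le_real.2 hc.le) hz
    refine ⟨fun s => ?_, fun h0 => ?_⟩
    · simpa using add_nonneg (hnn ha (hρ s)) (hnn hb (h₂ s))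
    · have h1 : ∀ s, (∀ p, s ≠ twoBlockString k l p) → ρ s s = 0 ∧ ρ' s s = 0 := by
        intro s hs
        have := h0 s hs
        simp only [Matrix.add_apply, Matrix.smul_apply, Complex.real_smul] at this
        rw [add_eq_zero_iff_of_nonneg (hnn ha (hρ s)) (hnn hb (h₂ s))] at this
        simpa [ha.ne', hb.ne'] using this
      have e : swapWitness (a • ρ + b • ρ') = a * swapWitness ρ + b * swapWitness ρ' := by
        simp [swapWitness, Finset.mul_sum, Finset.sum_add_distrib]
      rw [e]
      have := hρ' fun s hs => (h1 s hs).1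
      have := h₂' fun s hs => (h1 s hs).2
      positivity
  refine (convexHull_min ?_ hT h).2 hsupp
  rintro ρ ⟨P, hP, hρ⟩
  obtain ⟨A, hA, τ, σ, hτ, hσ, hprod⟩ := hρ.exists_split hP
  refine ⟨fun s => ?_, swapWitness_nonneg_of_product hA hτ.1 hσ.1 hprod⟩
  rw [hprod]
  exact mul_nonneg hτ.1.diag_nonneg hσ.1.diag_nonneg

theorem liftedWerner_mem_GME {d k l : ℕ} (hd : 2 ≤ d) (hk : 1 ≤ k) (hl : 1 ≤ l) {η : ℝ}
    (h0 : 1 / ((d : ℝ) + 1) < η) (h1 : η ≤ 1) :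
    toParties (liftedWerner d k l η) ∈ GME d (k + l) := by
  have hd0 : (0 : ℝ) < d := by exact_mod_cast (by omega : 0 < d)
  have hη : 0 < η := lt_trans (by positivity) h0
  refine ⟨?_, fun hsep => ?_⟩
  · rw [toParties_liftedWerner]
    exact (werner_isState hd hη.le h1).conjugate (liftIsometry_isometry hk hl)
  · have h := hsep.swapWitness_nonneg fun s hs => by
      rw [toParties_liftedWerner]
      exact lift_diag_eq_zero _ hs
    rw [swapWitness_liftedWerner hd hk hl, sub_nonneg, le_div_iff₀ hd0] at h
    rw [div_lt_iff₀ (by positivity)] at h0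
    linarith

/-! ### The standard Gaussian measure on `ℂ^d` -/

/-- The squared Hilbert space norm of a vector. -/
def sqNorm {d : ℕ} (y : Fin d → ℂ) : ℝ := ∑ i, ‖y i‖ ^ 2

/-- The Gaussian probability measure on `ℂ^d` with density `π⁻ᵈ exp (-‖y‖²)`. Its direction is
uniformly distributed on the unit sphere. -/
def complexGaussian (d : ℕ) : Measure (Fin d → ℂ) :=
  volume.withDensity fun y => ENNReal.ofReal ((Real.pi⁻¹) ^ d * Real.exp (-sqNorm y))

theorem sqNorm_nonneg {d : ℕ} (y : Fin d → ℂ) : 0 ≤ sqNorm y :=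
  Finset.sum_nonneg fun _ _ => sq_nonneg _

theorem sqNorm_eq_zero {d : ℕ} {y : Fin d → ℂ} : sqNorm y = 0 ↔ y = 0 := by
  rw [sqNorm, Finset.sum_eq_zero_iff_of_nonneg fun _ _ => sq_nonneg _]
  simp [funext_iff]

@[fun_prop]
theorem measurable_sqNorm {d : ℕ} : Measurable (sqNorm : (Fin d → ℂ) → ℝ) := by
  unfold sqNorm
  fun_prop

theorem integral_exp_neg_mul_sq_norm_complex {b : ℝ} (hb : 0 < b) :
    ∫ z : ℂ, Real.exp (-(b * ‖z‖ ^ 2)) = Real.pi / b := by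
  have := GaussianFourier.integral_rexp_neg_mul_sq_norm (V := ℂ) hb
  simpa [Complex.finrank_real_complex] using this

theorem integrable_exp_neg_mul_sq_norm_complex {b : ℝ} (hb : 0 < b) :
    Integrable fun z : ℂ => Real.exp (-(b * ‖z‖ ^ 2)) := by
  refine not_imp_comm.1 integral_undef ?_
  rw [integral_exp_neg_mul_sq_norm_complex hb]
  positivity

theorem exp_neg_mul_sqNorm {d : ℕ} (b : ℝ) (y : Fin d → ℂ) :
    Real.exp (-(b * sqNorm y)) = ∏ i, Real.exp (-(b * ‖y i‖ ^ 2)) := by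
  rw [← Real.exp_sum, Finset.sum_neg_distrib, ← Finset.mul_sum, sqNorm]

theorem integrable_exp_neg_mul_sqNorm {d : ℕ} {b : ℝ} (hb : 0 < b) :
    Integrable fun y : Fin d → ℂ => Real.exp (-(b * sqNorm y)) := by
  simp only [exp_neg_mul_sqNorm]
  exact Integrable.fintype_prod fun _ => integrable_exp_neg_mul_sq_norm_complex hb

theorem integral_exp_neg_mul_sqNorm {d : ℕ} {b : ℝ} (hb : 0 < b) :
    ∫ y : Fin d → ℂ, Real.exp (-(b * sqNorm y)) = (Real.pi / b) ^ d := by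
  simp only [exp_neg_mul_sqNorm]
  rw [integral_fintype_prod_volume_eq_pow fun z : ℂ => Real.exp (-(b * ‖z‖ ^ 2)),
    integral_exp_neg_mul_sq_norm_complex hb, Fintype.card_fin]

/-- In one complex dimension `|z|²` has an exponential tail. -/
theorem integral_indicator_exp_neg_sq_norm {a : ℝ} (ha : 0 ≤ a) :
    ∫ z : ℂ, (if a ≤ ‖z‖ ^ 2 then Real.exp (-‖z‖ ^ 2) else 0) = Real.pi * Real.exp (-a) := by
  have h := integral_fun_norm_addHaar (volume : Measure ℂ)
    (fun r : ℝ => if a ≤ r ^ 2 then Real.exp (-r ^ 2) else 0)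
  rw [h, Complex.finrank_real_complex]
  have hball : (volume : Measure ℂ).real (Metric.ball 0 1) = Real.pi := by
    simp [Measure.real, Complex.volume_ball]
  have hint : ∫ y in Set.Ioi (0 : ℝ), y ^ (2 - 1) • (if a ≤ y ^ 2 then Real.exp (-y ^ 2) else 0) =
      Real.exp (-a) / 2 := by
    have h1 : ∫ y in Set.Ioi (0 : ℝ),
        y ^ (2 - 1) • (if a ≤ y ^ 2 then Real.exp (-y ^ 2) else 0) =
        ∫ y in Set.Ici (√a), y * Real.exp (-y ^ 2) := by
      have : ∀ᵐ y ∂(volume.restrict (Set.Ioi (0 : ℝ))),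
          y ^ (2 - 1) • (if a ≤ y ^ 2 then Real.exp (-y ^ 2) else 0) =
            (Set.Ici (√a)).indicator (fun y => y * Real.exp (-y ^ 2)) y := by
        refine (ae_restrict_iff' measurableSet_Ioi).2 (.of_forall fun y hy => ?_)
        by_cases hay : a ≤ y ^ 2
        · rw [if_pos hay, Set.indicator_of_mem (Set.mem_Ici.2 (Real.sqrt_le_iff.2 ⟨le_of_lt hy, hay⟩))]
          simp
        · rw [if_neg hay, Set.indicator_of_notMem]
          · simp
          · intro hm
            exact hay (Real.sqrt_le_iff.1 hm).2
      rw [integral_congr_ae this, setIntegral_indicator measurableSet_Ici]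
      rw [integral_Ici_eq_integral_Ioi]
      refine setIntegral_congr_set ?_
      have : Set.Ioi (√a) ⊆ Set.Ioi 0 ∩ Set.Ici (√a) := fun y hy =>
        ⟨lt_of_le_of_lt (Real.sqrt_nonneg a) hy, le_of_lt (Set.mem_Ioi.1 hy)⟩
      refine Filter.EventuallyLE.antisymm ?_ this.eventuallyLE
      exact (Filter.EventuallyLE.trans (Set.inter_subset_right).eventuallyLE
        Ioi_ae_eq_Ici.symm.le)
    rw [h1, integral_Ici_eq_integral_Ioi]
    have h2 := integral_Ioi_of_hasDerivAt_of_nonneg' (a := √a) (l := 0)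
      (g := fun y : ℝ => -Real.exp (-y ^ 2) / 2) (g' := fun y => y * Real.exp (-y ^ 2))
      (fun y _ => by
        have h : HasDerivAt (fun y : ℝ => -Real.exp (-y ^ 2) / 2)
            (-(Real.exp (-y ^ 2) * -(2 * y)) / 2) y := by
          simpa using! (((hasDerivAt_pow 2 y).neg).exp.neg).div_const 2
        exact h.congr_deriv (by ring))
      (fun y hy => mul_nonneg (le_trans (Real.sqrt_nonneg a) (le_of_lt hy)) (Real.exp_pos _).le)
      (by
        have h3 : Filter.Tendsto (fun y : ℝ => -y ^ 2) Filter.atTop Filter.atBot :=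
          Filter.tendsto_neg_atTop_atBot.comp (Filter.tendsto_pow_atTop (by norm_num))
        simpa using ((Real.tendsto_exp_atBot.comp h3).neg).div_const 2)
    rw [h2, Real.sq_sqrt ha]
    ring
  rw [hball, hint]
  simp
  ring

theorem sqNorm_eq_add_succAbove {n : ℕ} (j : Fin (n + 1)) (y : Fin (n + 1) → ℂ) :
    sqNorm y = ‖y j‖ ^ 2 + sqNorm fun i => y (j.succAbove i) := by
  rw [sqNorm, sqNorm, Fin.sum_univ_succAbove _ j]

/-- The Gaussian weight of the vectors whose `j`-th coordinate dominates: integrating out that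
coordinate leaves a Gaussian integral with the exponent scaled by `1 + c`. -/
theorem integral_indicator_exp_neg_sqNorm {n : ℕ} (j : Fin (n + 1)) {c : ℝ} (hc : 0 ≤ c) :
    ∫ y in {y : Fin (n + 1) → ℂ | c * (sqNorm fun i => y (j.succAbove i)) ≤ ‖y j‖ ^ 2},
      Real.exp (-sqNorm y) = Real.pi ^ (n + 1) * ((1 + c) ^ n)⁻¹ := by
  let G : ℂ × (Fin n → ℂ) → ℝ := {p | c * sqNorm p.2 ≤ ‖p.1‖ ^ 2}.indicator
    fun p => Real.exp (-‖p.1‖ ^ 2) * Real.exp (-sqNorm p.2)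
  have hS : MeasurableSet {p : ℂ × (Fin n → ℂ) | c * sqNorm p.2 ≤ ‖p.1‖ ^ 2} :=
    measurableSet_le (by fun_prop) (by fun_prop)
  have hS' : MeasurableSet
      {y : Fin (n + 1) → ℂ | c * (sqNorm fun i => y (j.succAbove i)) ≤ ‖y j‖ ^ 2} :=
    measurableSet_le (measurable_const.mul (measurable_sqNorm.comp (by fun_prop))) (by fun_prop)
  have hG : Integrable G (volume.prod volume) := by
    refine Integrable.indicator (Integrable.mul_prod (f := fun z : ℂ => Real.exp (-‖z‖ ^ 2))
      (g := fun w : Fin n → ℂ => Real.exp (-sqNorm w)) ?_ ?_) hS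
    · simpa using integrable_exp_neg_mul_sq_norm_complex one_pos
    · simpa using integrable_exp_neg_mul_sqNorm (d := n) one_pos
  rw [← integral_indicator hS']
  have e1 : ∀ y : Fin (n + 1) → ℂ,
      {y : Fin (n + 1) → ℂ | c * (sqNorm fun i => y (j.succAbove i)) ≤ ‖y j‖ ^ 2}.indicator
        (fun y => Real.exp (-sqNorm y)) y =
        G (MeasurableEquiv.piFinSuccAbove (fun _ => ℂ) j y) := by
    intro y
    simp only [G, Set.indicator, Set.mem_ofPred_eq, sqNorm_eq_add_succAbove j y, neg_add,
      Real.exp_add]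
    rfl
  simp only [e1]
  rw [(volume_preserving_piFinSuccAbove (fun _ : Fin (n + 1) => ℂ) j).integral_comp'
    (g := G), Measure.volume_eq_prod, integral_prod_symm G hG]
  have e2 : ∀ w : Fin n → ℂ, ∫ z : ℂ, G (z, w) =
      Real.pi * Real.exp (-((1 + c) * sqNorm w)) := by
    intro w
    have : ∀ z : ℂ, G (z, w) = (if c * sqNorm w ≤ ‖z‖ ^ 2 then Real.exp (-‖z‖ ^ 2) else 0) *
        Real.exp (-sqNorm w) := by
      intro z
      simp only [G, Set.indicator, Set.mem_ofPred_eq, ite_mul, zero_mul]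
    simp only [this]
    rw [integral_mul_const, integral_indicator_exp_neg_sq_norm (mul_nonneg hc (sqNorm_nonneg w)),
      mul_assoc, ← Real.exp_add]
    ring_nf
  simp only [e2]
  rw [integral_const_mul, integral_exp_neg_mul_sqNorm (by positivity), div_pow, pow_succ]
  ring

theorem complexGaussian_apply {d : ℕ} {s : Set (Fin d → ℂ)} (hs : MeasurableSet s) :
    complexGaussian d s =
      ENNReal.ofReal ((Real.pi⁻¹) ^ d * ∫ y in s, Real.exp (-sqNorm y)) := by
  rw [complexGaussian, withDensity_apply _ hs, ← integral_const_mul,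
    ofReal_integral_eq_lintegral_ofReal]
  · have := integrable_exp_neg_mul_sqNorm (d := d) one_pos
    simp only [one_mul] at this
    exact (this.const_mul _).integrableOn
  · exact .of_forall fun y => by positivity

instance (d : ℕ) : IsProbabilityMeasure (complexGaussian d) := by
  constructor
  have := integral_exp_neg_mul_sqNorm (d := d) one_pos
  simp only [one_mul, div_one] at this
  rw [complexGaussian_apply .univ, Measure.restrict_univ, this, ← mul_pow,
    inv_mul_cancel₀ Real.pi_ne_zero]
  simp

theorem complexGaussian_singleton_zero {d : ℕ} (hd : 0 < d) : complexGaussian d {0} = 0 := by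
  have : Nonempty (Fin d) := ⟨⟨0, hd⟩⟩
  exact withDensity_absolutelyContinuous _ _ (measure_singleton 0)

theorem ae_ne_zero_complexGaussian {d : ℕ} (hd : 0 < d) : ∀ᵐ y ∂complexGaussian d, y ≠ 0 := by
  simpa [ae_iff] using complexGaussian_singleton_zero hd

/-- Linear isometries preserve the Gaussian measure: they rescale volume by a constant and preserve
the density, and the constant is one because the total mass is. -/
theorem measurePreserving_complexGaussian {d : ℕ} (L : (Fin d → ℂ) →ₗ[ℂ] (Fin d → ℂ))
    (hL : ∀ y, sqNorm (L y) = sqNorm y) :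
    MeasurePreserving L (complexGaussian d) (complexGaussian d) := by
  let L' : (Fin d → ℂ) →ₗ[ℝ] (Fin d → ℂ) := L.restrictScalars ℝ
  have hinj : Function.Injective L' := by
    rw [injective_iff_map_eq_zero]
    intro y hy
    rw [← sqNorm_eq_zero, ← hL, show L y = 0 from hy, sqNorm_eq_zero]
  have hdet : LinearMap.det L' ≠ 0 :=
    ((LinearEquiv.ofInjectiveEndo L' hinj).isUnit_det').ne_zero
  have hmeas : Measurable L := L'.continuous_of_finiteDimensional.measurable
  have hvol := Measure.map_linearMap_addHaar_eq_smul_addHaar (μ := volume) hdet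
  have hmap : (complexGaussian d).map L =
      ENNReal.ofReal |(LinearMap.det L')⁻¹| • complexGaussian d := by
    ext s hs
    rw [Measure.map_apply hmeas hs, complexGaussian, withDensity_apply _ (hmeas hs),
      Measure.smul_apply, withDensity_apply _ hs, smul_eq_mul]
    have h1 : ∫⁻ y in s, ENNReal.ofReal ((Real.pi⁻¹) ^ d * Real.exp (-sqNorm y))
        ∂(Measure.map L' volume) = ∫⁻ y in L ⁻¹' s,
          ENNReal.ofReal ((Real.pi⁻¹) ^ d * Real.exp (-sqNorm (L y))) :=
      setLIntegral_map hs (by fun_prop) hmeas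
    rw [hvol, Measure.restrict_smul, lintegral_smul_measure] at h1
    simp only [hL] at h1
    exact h1.symm
  refine ⟨hmeas, ?_⟩
  have h1 : (complexGaussian d).map L Set.univ = 1 := by
    rw [Measure.map_apply hmeas .univ, Set.preimage_univ, measure_univ]
  rw [hmap, Measure.smul_apply, measure_univ, smul_eq_mul, mul_one] at h1
  rw [hmap, h1, one_smul]

/-! ### The distribution of the overlap with a basis vector -/

/-- The squared overlap `|⟨j|y⟩|² / ‖y‖²` of the direction of `y` with the `j`-th basis vector (zero
for `y = 0`). -/
def overlap {d : ℕ} (j : Fin d) (y : Fin d → ℂ) : ℝ := ‖y j‖ ^ 2 / sqNorm y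

@[fun_prop]
theorem measurable_overlap {d : ℕ} (j : Fin d) : Measurable (overlap j) := by
  unfold overlap
  fun_prop

theorem overlap_nonneg {d : ℕ} (j : Fin d) (y : Fin d → ℂ) : 0 ≤ overlap j y :=
  div_nonneg (sq_nonneg _) (sqNorm_nonneg y)

theorem overlap_le_one {d : ℕ} (j : Fin d) (y : Fin d → ℂ) : overlap j y ≤ 1 :=
  div_le_one_of_le₀ (Finset.single_le_sum (f := fun i => ‖y i‖ ^ 2) (fun _ _ => sq_nonneg _)
    (Finset.mem_univ j)) (sqNorm_nonneg y)

theorem sum_overlap {d : ℕ} {y : Fin d → ℂ} (hy : y ≠ 0) : ∑ j, overlap j y = 1 := by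
  simp only [overlap]
  rw [← Finset.sum_div]
  exact div_self (sqNorm_eq_zero.not.2 hy)

/-- For a Gaussian vector the overlap is at least `s` with probability `(1 - s)^(d - 1)`. -/
theorem complexGaussian_le_overlap {n : ℕ} (j : Fin (n + 1)) {s : ℝ} (h0 : 0 < s) (h1 : s < 1) :
    complexGaussian (n + 1) {y | s ≤ overlap j y} = ENNReal.ofReal ((1 - s) ^ n) := by
  have h1' : 0 < 1 - s := by linarith
  have hset : {y : Fin (n + 1) → ℂ | s ≤ overlap j y} =
      {y | s / (1 - s) * (sqNorm fun i => y (j.succAbove i)) ≤ ‖y j‖ ^ 2} \ {0} := by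
    ext y
    by_cases hy : y = 0
    · subst hy
      simp [overlap, h0]
    · have hpos : 0 < sqNorm y := lt_of_le_of_ne (sqNorm_nonneg y) (Ne.symm (sqNorm_eq_zero.not.2 hy))
      have e := sqNorm_eq_add_succAbove j y
      simp only [Set.mem_ofPred_eq, Set.mem_sdiff, Set.mem_singleton_iff, hy, not_false_eq_true,
        and_true, overlap]
      rw [le_div_iff₀ hpos, e, div_mul_eq_mul_div, div_le_iff₀ h1']
      constructor <;> intro h <;> linarith
  have hm : MeasurableSet {y : Fin (n + 1) → ℂ |
      s / (1 - s) * (sqNorm fun i => y (j.succAbove i)) ≤ ‖y j‖ ^ 2} :=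
    measurableSet_le (measurable_const.mul (measurable_sqNorm.comp (by fun_prop))) (by fun_prop)
  rw [hset, measure_sdiff_null (complexGaussian_singleton_zero n.succ_pos),
    complexGaussian_apply hm,
    integral_indicator_exp_neg_sqNorm j (by positivity), ← mul_assoc, ← mul_pow,
    inv_mul_cancel₀ Real.pi_ne_zero, one_pow, one_mul]
  have e : 1 + s / (1 - s) = (1 - s)⁻¹ := by field_simp; ring
  rw [e, inv_pow, inv_inv]

/-- The acceptance function `u · 1{u ≥ 1/d}` of the local hidden state model. -/
def threshold (d : ℕ) (u : ℝ) : ℝ := if 1 / (d : ℝ) ≤ u then u else 0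

@[fun_prop]
theorem measurable_threshold (d : ℕ) : Measurable (threshold d) :=
  Measurable.ite measurableSet_Ici measurable_id measurable_const

theorem threshold_nonneg {d : ℕ} {u : ℝ} (hu : 0 ≤ u) : 0 ≤ threshold d u := by
  unfold threshold
  split_ifs <;> simp [hu]

theorem threshold_le {d : ℕ} {u : ℝ} (hu : 0 ≤ u) : threshold d u ≤ u := by
  unfold threshold
  split_ifs <;> simp [hu]

theorem integral_sub_pow_mul {n : ℕ} (q c : ℝ) :
    ∫ t in (0 : ℝ)..q, (q - t) ^ n * (2 * c * t + 1) =
      (2 * c * q + 1) * q ^ (n + 1) / (n + 1) - 2 * c * q ^ (n + 2) / (n + 2) := by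
  have hd : ∀ t : ℝ, HasDerivAt (fun t : ℝ =>
      -(2 * c * q + 1) * (q - t) ^ (n + 1) / (n + 1) + 2 * c * (q - t) ^ (n + 2) / (n + 2))
      ((q - t) ^ n * (2 * c * t + 1)) t := by
    intro t
    have h0 : HasDerivAt (fun t : ℝ => q - t) (-1) t := by
      simpa using (hasDerivAt_id t).const_sub q
    have h1 := ((h0.pow (n + 1)).const_mul (-(2 * c * q + 1))).div_const ((n : ℝ) + 1)
    have h2 := ((h0.pow (n + 2)).const_mul (2 * c)).div_const ((n : ℝ) + 2)
    refine (h1.add h2).congr_deriv ?_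
    have e1 : (n : ℝ) + 1 ≠ 0 := by positivity
    have e2 : (n : ℝ) + 2 ≠ 0 := by positivity
    simp only [Nat.add_sub_cancel, show n + 2 - 1 = n + 1 from rfl]
    push_cast
    field_simp
    ring
  rw [intervalIntegral.integral_eq_sub_of_hasDerivAt (fun t _ => hd t)
    (Continuous.intervalIntegrable (by fun_prop) _ _)]
  simp
  ring

/-- The integral `∫₀^q (q - t)ⁿ (2 d t + 1) dt` for `d = n + 1` and `q = 1 - 1/d`, in terms of the
visibility bound. -/
theorem visibilityBound_succ {n : ℕ} :
    ((2 * (n + 1 : ℝ) * (n / (n + 1)) + 1) * (n / (n + 1) : ℝ) ^ (n + 1) / (n + 1) -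
      2 * (n + 1 : ℝ) * (n / (n + 1) : ℝ) ^ (n + 2) / (n + 2)) =
      n / (n + 1) * visibilityBound (n + 1) := by
  have e1 : (n : ℝ) + 1 ≠ 0 := by positivity
  have e2 : (n : ℝ) + 2 ≠ 0 := by positivity
  have e3 : (n : ℝ) + 1 + 1 ≠ 0 := by positivity
  simp only [visibilityBound, div_pow, Nat.add_sub_cancel]
  push_cast
  field_simp
  ring

/-- The layer cake formula turns the tail of the overlap `u` into the expectation of
`u (d u - 1) 1{u ≥ 1/d} = d f² + f`, where `f` is the positive part of `u - 1/d`. -/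
theorem integral_threshold_gain {d : ℕ} (hd : 2 ≤ d) (j : Fin d) :
    ∫ y, threshold d (overlap j y) * (d * overlap j y - 1) ∂complexGaussian d =
      ((d : ℝ) - 1) / d * visibilityBound d := by
  obtain ⟨n, rfl⟩ : ∃ n, d = n + 1 := ⟨d - 1, by omega⟩
  have hn : (0 : ℝ) < n := by exact_mod_cast (by omega : 0 < n)
  set c : ℝ := ((n + 1 : ℕ) : ℝ) with hc
  have hc' : c = n + 1 := by rw [hc]; push_cast; rfl
  have hc0 : 0 < c := by rw [hc']; positivity
  set q : ℝ := n / (n + 1) with hq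
  have hq0 : 0 < q := by positivity
  have hqc : q + 1 / c = 1 := by rw [hq, hc']; field_simp
  let f : (Fin (n + 1) → ℂ) → ℝ := fun y => max (overlap j y - 1 / c) 0
  have hf0 : ∀ y, 0 ≤ f y := fun y => le_max_right _ _
  have hfm : Measurable f := by fun_prop
  have e1 : ∀ y, threshold (n + 1) (overlap j y) * (c * overlap j y - 1) = c * f y ^ 2 + f y := by
    intro y
    simp only [threshold, f, ← hc]
    split_ifs with h
    · rw [max_eq_left (by linarith)]
      field_simp
      ring
    · rw [max_eq_right (by linarith)]
      simp
  have e2 : ∀ y, ∫ t in (0 : ℝ)..f y, (2 * c * t + 1) = c * f y ^ 2 + f y := by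
    intro y
    rw [intervalIntegral.integral_add (Continuous.intervalIntegrable (by fun_prop) _ _)
      (Continuous.intervalIntegrable (by fun_prop) _ _), intervalIntegral.integral_const_mul,
      integral_id, intervalIntegral.integral_const]
    simp
    ring
  have hnn : ∀ y, 0 ≤ c * f y ^ 2 + f y := fun y => by have := hf0 y; positivity
  have hlayer := lintegral_comp_eq_lintegral_meas_le_mul (complexGaussian (n + 1)) (f := f)
    (g := fun t => 2 * c * t + 1) (.of_forall hf0) hfm.aemeasurable
    (fun t _ => Continuous.intervalIntegrable (by fun_prop) _ _)
    ((ae_restrict_iff' measurableSet_Ioi).2 (.of_forall fun t ht => by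
      have : 0 < t := ht
      positivity))
  have htail : ∫⁻ t in Set.Ioi (0 : ℝ), complexGaussian (n + 1) {y | t ≤ f y} *
      ENNReal.ofReal (2 * c * t + 1) =
      ∫⁻ t in Set.Ioc (0 : ℝ) q, ENNReal.ofReal ((q - t) ^ n * (2 * c * t + 1)) := by
    have hae : ∀ᵐ t ∂(volume.restrict (Set.Ioi (0 : ℝ))),
        complexGaussian (n + 1) {y | t ≤ f y} * ENNReal.ofReal (2 * c * t + 1) =
        (Set.Ioc (0 : ℝ) q).indicator
          (fun t => ENNReal.ofReal ((q - t) ^ n * (2 * c * t + 1))) t := by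
      -- The tail formula covers thresholds below one, that is `t < q`.
      have hne : ∀ᵐ t ∂(volume : Measure ℝ), t ≠ q := by simp [ae_iff]
      refine (ae_restrict_iff' measurableSet_Ioi).2 (hne.mono fun t htq ht => ?_)
      have ht0 : 0 < t := ht
      have hset : {y | t ≤ f y} = {y | t + 1 / c ≤ overlap j y} := by
        ext y
        simp only [f, Set.mem_ofPred_eq, le_max_iff, not_le.2 ht0, or_false]
        exact le_sub_iff_add_le
      rw [hset]
      rcases lt_or_gt_of_ne htq with h | h
      · rw [Set.indicator_of_mem (Set.mem_Ioc.2 ⟨ht0, h.le⟩),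
          complexGaussian_le_overlap j (by positivity) (by linarith), ← ENNReal.ofReal_mul]
        · congr 3
          linarith
        · exact pow_nonneg (by linarith) n
      · rw [Set.indicator_of_notMem fun hm => absurd (Set.mem_Ioc.1 hm).2 (not_le.2 h)]
        have : {y : Fin (n + 1) → ℂ | t + 1 / c ≤ overlap j y} = ∅ := by
          refine Set.eq_empty_of_forall_notMem fun y hy => ?_
          have h1 : t + 1 / c ≤ overlap j y := hy
          have := overlap_le_one j y
          linarith
        rw [this]
        simp
    rw [lintegral_congr_ae hae, setLIntegral_indicator measurableSet_Ioc,
      Set.inter_eq_left.2 Set.Ioc_subset_Ioi_self]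
  simp only [e1]
  rw [integral_eq_lintegral_of_nonneg_ae (.of_forall hnn)
    (by exact Measurable.aestronglyMeasurable (by fun_prop))]
  simp only [e2] at hlayer
  rw [hlayer, htail, ← ofReal_integral_eq_lintegral_ofReal]
  · rw [← intervalIntegral.integral_of_le hq0.le, integral_sub_pow_mul, ENNReal.toReal_ofReal]
    · rw [hc', hq, visibilityBound_succ]
      congr 2
      ring
    · rw [← integral_sub_pow_mul]
      refine intervalIntegral.integral_nonneg hq0.le fun t ht => ?_
      have := ht.1
      have := sub_nonneg.2 ht.2
      positivity
  · exact (Continuous.integrableOn_Icc (by fun_prop)).mono_set Set.Ioc_subset_Icc_self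
  · refine (ae_restrict_iff' measurableSet_Ioc).2 (.of_forall fun t ht => ?_)
    have := ht.1.le
    have := sub_nonneg.2 ht.2
    dsimp only [Pi.zero_apply]
    positivity

/-! ### Second moments of the direction of a Gaussian vector -/

/-- The projector onto the direction of `y`. -/
def direction {d : ℕ} (y : Fin d → ℂ) : Matrix (Fin d) (Fin d) ℂ :=
  Matrix.of fun s t => y s * star (y t) / (sqNorm y : ℂ)

theorem direction_apply {d : ℕ} (y : Fin d → ℂ) (s t : Fin d) :
    direction y s t = y s * star (y t) / (sqNorm y : ℂ) := rfl

@[fun_prop]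
theorem measurable_direction {d : ℕ} (s t : Fin d) :
    Measurable fun y : Fin d → ℂ => direction y s t := by
  simp only [direction_apply]
  fun_prop

theorem direction_self {d : ℕ} (y : Fin d → ℂ) (s : Fin d) :
    direction y s s = (overlap s y : ℂ) := by
  rw [direction_apply, overlap, Complex.star_def, Complex.mul_conj, Complex.normSq_eq_norm_sq]
  push_cast
  rfl

theorem norm_direction_le_one {d : ℕ} (y : Fin d → ℂ) (s t : Fin d) : ‖direction y s t‖ ≤ 1 := by
  rw [direction_apply, norm_div, norm_mul, norm_star, Complex.norm_real,
    Real.norm_of_nonneg (sqNorm_nonneg y)]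
  refine div_le_one_of_le₀ ?_ (sqNorm_nonneg y)
  have h : ∀ i, ‖y i‖ ^ 2 ≤ sqNorm y := fun i =>
    Finset.single_le_sum (f := fun i => ‖y i‖ ^ 2) (fun _ _ => sq_nonneg _) (Finset.mem_univ i)
  nlinarith [h s, h t, sq_nonneg (‖y s‖ - ‖y t‖)]

theorem integrable_mul_direction {d : ℕ} {F : (Fin d → ℂ) → ℝ} (hF : Measurable F) {C : ℝ}
    (hC : ∀ y, |F y| ≤ C) (s t : Fin d) :
    Integrable (fun y => (F y : ℂ) * direction y s t) (complexGaussian d) := by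
  refine .of_bound (Measurable.aestronglyMeasurable (by fun_prop)) C (.of_forall fun y => ?_)
  rw [norm_mul, Complex.norm_real, Real.norm_eq_abs]
  exact (mul_le_of_le_one_right (abs_nonneg _) (norm_direction_le_one y s t)).trans (hC y)

/-- Flipping the sign of the coordinate `s`. -/
def signFlip {d : ℕ} (s : Fin d) : (Fin d → ℂ) →ₗ[ℂ] (Fin d → ℂ) where
  toFun y i := if i = s then -y i else y i
  map_add' y z := by ext i; by_cases h : i = s <;> simp [h, add_comm]
  map_smul' c y := by ext i; by_cases h : i = s <;> simp [h]

/-- Permuting the coordinates. -/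
def permute {d : ℕ} (e : Equiv.Perm (Fin d)) : (Fin d → ℂ) →ₗ[ℂ] (Fin d → ℂ) :=
  LinearMap.funLeft ℂ ℂ e

theorem permute_apply {d : ℕ} (e : Equiv.Perm (Fin d)) (y : Fin d → ℂ) (i : Fin d) :
    permute e y i = y (e i) := rfl

theorem signFlip_apply {d : ℕ} (s : Fin d) (y : Fin d → ℂ) (i : Fin d) :
    signFlip s y i = if i = s then -y i else y i := rfl

theorem norm_signFlip {d : ℕ} (s : Fin d) (y : Fin d → ℂ) (i : Fin d) :
    ‖signFlip s y i‖ = ‖y i‖ := by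
  rw [signFlip_apply]
  split_ifs <;> simp

theorem sqNorm_signFlip {d : ℕ} (s : Fin d) (y : Fin d → ℂ) :
    sqNorm (signFlip s y) = sqNorm y := by
  simp only [sqNorm, norm_signFlip]

theorem sqNorm_permute {d : ℕ} (e : Equiv.Perm (Fin d)) (y : Fin d → ℂ) :
    sqNorm (permute e y) = sqNorm y :=
  Equiv.sum_comp e fun i => ‖y i‖ ^ 2

theorem overlap_signFlip {d : ℕ} (s j : Fin d) (y : Fin d → ℂ) :
    overlap j (signFlip s y) = overlap j y := by
  simp only [overlap, norm_signFlip, sqNorm_signFlip]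

theorem overlap_permute {d : ℕ} (e : Equiv.Perm (Fin d)) (j : Fin d) (y : Fin d → ℂ) :
    overlap j (permute e y) = overlap (e j) y := by
  simp only [overlap, permute_apply, sqNorm_permute]

theorem integral_comp_isometry {d : ℕ} {E : Type*} [NormedAddCommGroup E] [NormedSpace ℝ E]
    (L : (Fin d → ℂ) →ₗ[ℂ] (Fin d → ℂ)) (hL : ∀ y, sqNorm (L y) = sqNorm y)
    {F : (Fin d → ℂ) → E} (hF : StronglyMeasurable F) :
    ∫ y, F (L y) ∂complexGaussian d = ∫ y, F y ∂complexGaussian d := by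
  have h := measurePreserving_complexGaussian L hL
  conv_rhs => rw [← h.map_eq]
  exact (integral_map_of_stronglyMeasurable h.measurable hF).symm

/-- Off-diagonal second moments vanish, by the symmetry under sign flips. -/
theorem integral_mul_direction_of_ne {d : ℕ} {F : (Fin d → ℂ) → ℝ} (hF : Measurable F)
    {s t : Fin d} (hst : s ≠ t) (hinv : ∀ y, F (signFlip s y) = F y) :
    ∫ y, (F y : ℂ) * direction y s t ∂complexGaussian d = 0 := by
  have h := integral_comp_isometry (signFlip s) (sqNorm_signFlip s)
    (F := fun y => (F y : ℂ) * direction y s t) (Measurable.stronglyMeasurable (by fun_prop))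
  have e : ∀ y, (F (signFlip s y) : ℂ) * direction (signFlip s y) s t =
      -((F y : ℂ) * direction y s t) := by
    intro y
    simp only [direction_apply, hinv, sqNorm_signFlip, signFlip_apply, if_true, if_neg hst.symm]
    ring
  simp only [e] at h
  rw [integral_neg] at h
  exact self_eq_neg.1 h.symm

theorem integral_overlap_eq {d : ℕ} {φ : ℝ → ℝ} (hφ : Measurable φ) (i j : Fin d) :
    ∫ y, φ (overlap i y) ∂complexGaussian d = ∫ y, φ (overlap j y) ∂complexGaussian d := by
  rw [← integral_comp_isometry (permute (Equiv.swap i j)) (sqNorm_permute _)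
    (Measurable.stronglyMeasurable (by fun_prop))]
  simp only [overlap_permute, Equiv.swap_apply_left]

theorem integrable_of_overlap {d : ℕ} {F : (Fin d → ℂ) → ℝ} (hF : Measurable F)
    (h0 : ∀ y, 0 ≤ F y) (h1 : ∀ y, F y ≤ 1) : Integrable F (complexGaussian d) :=
  integrable_of_mem_unitInterval hF h0 h1

/-- The direction of a Gaussian vector is maximally mixed on average. -/
theorem integral_direction {d : ℕ} (hd : 0 < d) (s t : Fin d) :
    ∫ y, direction y s t ∂complexGaussian d = if s = t then (1 / d : ℂ) else 0 := by
  split_ifs with hst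
  · subst hst
    simp only [direction_self]
    rw [integral_complex_ofReal]
    have hsum : ∑ i : Fin d, ∫ y, overlap i y ∂complexGaussian d = 1 := by
      rw [← integral_finsetSum _ fun i _ =>
        integrable_of_overlap (measurable_overlap i) (overlap_nonneg i) (overlap_le_one i)]
      rw [integral_congr_ae ((ae_ne_zero_complexGaussian hd).mono fun y hy => sum_overlap hy)]
      simp
    have heq : ∀ i : Fin d, ∫ y, overlap i y ∂complexGaussian d =
        ∫ y, overlap s y ∂complexGaussian d :=
      fun i => integral_overlap_eq (φ := id) measurable_id i s
    rw [Finset.sum_congr rfl fun i _ => heq i] at hsum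
    simp only [Finset.sum_const, Finset.card_univ, Fintype.card_fin, nsmul_eq_mul] at hsum
    have hd' : (d : ℝ) ≠ 0 := by exact_mod_cast hd.ne'
    rw [(eq_div_iff hd').2 ((mul_comm _ _).trans hsum)]
    push_cast
    rfl
  · simpa using integral_mul_direction_of_ne (F := fun _ => 1) measurable_const hst fun _ => rfl

/-- The mean acceptance probability of a basis vector. It is the same for all of them, and its value
plays no role: it cancels in the model. -/
def meanThreshold (d : ℕ) (j : Fin d) : ℝ := ∫ y, threshold d (overlap j y) ∂complexGaussian d

theorem meanThreshold_eq {d : ℕ} (i j : Fin d) : meanThreshold d i = meanThreshold d j :=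
  integral_overlap_eq (measurable_threshold d) i j

theorem threshold_overlap_nonneg {d : ℕ} (j : Fin d) (y : Fin d → ℂ) :
    0 ≤ threshold d (overlap j y) := threshold_nonneg (overlap_nonneg j y)

theorem threshold_overlap_le_one {d : ℕ} (j : Fin d) (y : Fin d → ℂ) :
    threshold d (overlap j y) ≤ 1 := (threshold_le (overlap_nonneg j y)).trans (overlap_le_one j y)

/-- Averaged over the accepted directions, the projector onto the direction is a combination of the
projector onto the basis vector and the identity. The coefficient of the former comes from
`integral_threshold_gain`; the other one is determined by the trace. -/
theorem integral_threshold_mul_direction {d : ℕ} (hd : 2 ≤ d) (j s t : Fin d) :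
    ∫ y, (threshold d (overlap j y) : ℂ) * direction y s t ∂complexGaussian d =
      (visibilityBound d / d * (if s = j ∧ t = j then 1 else 0) +
        (meanThreshold d j - visibilityBound d / d) / d * (if s = t then 1 else 0) : ℝ) := by
  have hd0 : (d : ℝ) ≠ 0 := by exact_mod_cast (by omega : d ≠ 0)
  have hd1 : (d : ℝ) - 1 ≠ 0 := sub_ne_zero.2 (by exact_mod_cast (by omega : d ≠ 1))
  by_cases hst : s = t
  swap
  · rw [integral_mul_direction_of_ne (F := fun y => threshold d (overlap j y)) (by fun_prop) hst
      fun y => by rw [overlap_signFlip]]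
    have : ¬ (s = j ∧ t = j) := fun h => hst (h.1.trans h.2.symm)
    simp [hst, this]
  subst hst
  simp only [direction_self, ← Complex.ofReal_mul]
  rw [integral_complex_ofReal]
  congr 1
  let M : Fin d → ℝ := fun i => ∫ y, threshold d (overlap j y) * overlap i y ∂complexGaussian d
  have hint : ∀ i, Integrable (fun y => threshold d (overlap j y) * overlap i y)
      (complexGaussian d) := fun i =>
    integrable_of_overlap (by fun_prop)
      (fun y => mul_nonneg (threshold_overlap_nonneg j y) (overlap_nonneg i y))
      (fun y => mul_le_one₀ (threshold_overlap_le_one j y) (overlap_nonneg i y) (overlap_le_one i y))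
  have hint' : Integrable (fun y => threshold d (overlap j y)) (complexGaussian d) :=
    integrable_of_overlap (by fun_prop) (threshold_overlap_nonneg j) (threshold_overlap_le_one j)
  have hgain : d * M j - meanThreshold d j = (d - 1) / d * visibilityBound d := by
    rw [← integral_threshold_gain hd j]
    have : ∀ y, threshold d (overlap j y) * (d * overlap j y - 1) =
        d * (threshold d (overlap j y) * overlap j y) - threshold d (overlap j y) :=
      fun y => by ring
    simp only [this]
    rw [integral_sub ((hint j).const_mul _) hint', integral_const_mul]
    rfl
  have hsum : ∑ i, M i = meanThreshold d j := by
    simp only [M]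
    rw [← integral_finsetSum _ fun i _ => hint i]
    refine integral_congr_ae ((ae_ne_zero_complexGaussian (by omega)).mono fun y hy => ?_)
    dsimp only
    rw [← Finset.mul_sum, sum_overlap hy, mul_one]
  have hM : ∀ i k, i ≠ j → k ≠ j → M i = M k := by
    intro i k hi hk
    simp only [M]
    rw [← integral_comp_isometry (permute (Equiv.swap i k)) (sqNorm_permute _)
      (Measurable.stronglyMeasurable (by fun_prop))]
    simp only [overlap_permute, Equiv.swap_apply_left, Equiv.swap_apply_of_ne_of_ne hi.symm hk.symm]
  change M s = _
  have hMj : M j = visibilityBound d / d + (meanThreshold d j - visibilityBound d / d) / d := by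
    field_simp at hgain ⊢
    linarith
  by_cases hs : s = j
  · subst hs
    simpa using hMj
  · have h2 : ∑ i, M i = M j + (d - 1) * M s := by
      rw [← Finset.add_sum_erase _ _ (Finset.mem_univ j),
        Finset.sum_congr rfl fun i hi => hM i s (Finset.ne_of_mem_erase hi) hs]
      simp [Finset.card_erase_of_mem, Nat.cast_sub (by omega : 1 ≤ d)]
    have h3 : M s = (meanThreshold d j - M j) / (d - 1) := by
      rw [eq_div_iff hd1]
      linarith
    rw [h3, hMj]
    simp only [hs, false_and, if_false, if_true]
    field_simp
    ring

/-! ### The local hidden state model of the Werner states -/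

theorem ofReal_sqNorm {d : ℕ} (y : Fin d → ℂ) : (sqNorm y : ℂ) = star y ⬝ᵥ y := by
  simp only [sqNorm, dotProduct, Pi.star_apply, Complex.star_def, ← Complex.normSq_eq_conj_mul_self,
    Complex.normSq_eq_norm_sq]
  push_cast
  rfl

theorem sqNorm_mulVec {d : ℕ} {U : Matrix (Fin d) (Fin d) ℂ} (hU : U.conjTranspose * U = 1)
    (y : Fin d → ℂ) : sqNorm (U.mulVec y) = sqNorm y := by
  have : (sqNorm (U.mulVec y) : ℂ) = sqNorm y := by
    rw [ofReal_sqNorm, ofReal_sqNorm, Matrix.star_mulVec, Matrix.dotProduct_mulVec,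
      Matrix.vecMul_vecMul, hU, Matrix.vecMul_one]
  exact_mod_cast this

theorem direction_eq_smul {d : ℕ} (y : Fin d → ℂ) :
    direction y = (sqNorm y : ℂ)⁻¹ • Matrix.vecMulVec y (star y) := by
  ext s t
  simp [direction_apply, Matrix.vecMulVec_apply, div_eq_inv_mul]

theorem direction_mulVec {d : ℕ} {U : Matrix (Fin d) (Fin d) ℂ} (hU : U.conjTranspose * U = 1)
    (y : Fin d → ℂ) : direction (U.mulVec y) = U * direction y * U.conjTranspose := by
  rw [direction_eq_smul, direction_eq_smul, sqNorm_mulVec hU, Matrix.mul_smul, Matrix.smul_mul,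
    Matrix.mul_vecMulVec, Matrix.vecMulVec_mul, Matrix.star_mulVec]

theorem direction_conjTranspose {d : ℕ} (y : Fin d → ℂ) :
    (direction y).conjTranspose = direction y := by
  ext s t
  simp [Matrix.conjTranspose_apply, direction_apply, mul_comm]

theorem direction_mul_self {d : ℕ} (y : Fin d → ℂ) : direction y * direction y = direction y := by
  by_cases hy : y = 0
  · subst hy
    ext s t
    simp [Matrix.mul_apply, direction_apply]
  · have h : (sqNorm y : ℂ) ≠ 0 := by exact_mod_cast sqNorm_eq_zero.not.2 hy
    rw [direction_eq_smul, Matrix.smul_mul, Matrix.mul_smul, Matrix.vecMulVec_mul_vecMulVec,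
      ← ofReal_sqNorm, Matrix.vecMulVec_smul, smul_smul, smul_smul]
    congr 1
    field_simp

theorem trace_direction {d : ℕ} {y : Fin d → ℂ} (hy : y ≠ 0) : (direction y).trace = 1 := by
  simp only [Matrix.trace, Matrix.diag, direction_self]
  rw [← Complex.ofReal_sum, sum_overlap hy, Complex.ofReal_one]

theorem trace_direction_re_le_one {d : ℕ} (y : Fin d → ℂ) : (direction y).trace.re ≤ 1 := by
  by_cases hy : y = 0
  · subst hy
    simp [Matrix.trace, direction_apply]
  · rw [trace_direction hy, Complex.one_re]

/-- A positive semidefinite matrix in an orthonormal eigenbasis. -/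
theorem Matrix.PosSemidef.exists_diagonalization {d : ℕ} {A : Matrix (Fin d) (Fin d) ℂ}
    (hA : A.PosSemidef) : ∃ (U : Matrix (Fin d) (Fin d) ℂ) (x : Fin d → ℝ),
      U.conjTranspose * U = 1 ∧ U * U.conjTranspose = 1 ∧ (∀ j, 0 ≤ x j) ∧
      A = U * Matrix.diagonal (fun j => (x j : ℂ)) * U.conjTranspose := by
  refine ⟨hA.1.eigenvectorUnitary, hA.1.eigenvalues, ?_, ?_, hA.eigenvalues_nonneg, ?_⟩
  · exact Unitary.coe_star_mul_self _
  · exact Unitary.coe_mul_star_self _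
  · have := hA.1.spectral_theorem
    rw [Unitary.conjStarAlgAut_apply] at this
    exact this

theorem integral_conjugate {Λ : Type*} [MeasurableSpace Λ] {μ : Measure Λ} {d : ℕ}
    {G : Λ → Matrix (Fin d) (Fin d) ℂ} (hG : ∀ s t, Integrable (fun v => G v s t) μ)
    (U V : Matrix (Fin d) (Fin d) ℂ) (s t : Fin d) :
    ∫ v, (U * G v * V) s t ∂μ = (U * (Matrix.of fun s t => ∫ v, G v s t ∂μ) * V) s t := by
  simp only [Matrix.mul_apply, Matrix.of_apply]
  rw [integral_finsetSum _ fun r _ =>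
    (integrable_finsetSum _ fun p _ => (hG p r).const_mul (U s p)).mul_const (V r t)]
  refine Finset.sum_congr rfl fun r _ => ?_
  rw [integral_mul_const, integral_finsetSum _ fun p _ => (hG p r).const_mul (U s p)]
  simp only [integral_const_mul]

/-- The acceptance function of an effect `A = ∑ x_j |j⟩⟨j|`, given in an eigenbasis: the effect
`x_j |j⟩⟨j|` is accepted with probability `x_j u_j` if the overlap `u_j` of the hidden direction
with `|j⟩` is at least `1/d`, and never otherwise. -/
theorem exists_acceptance {d : ℕ} (hd : 2 ≤ d) (j₀ : Fin d) {A : Matrix (Fin d) (Fin d) ℂ}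
    (hA : A.PosSemidef) : ∃ w : (Fin d → ℂ) → ℝ, Measurable w ∧ (∀ v, 0 ≤ w v) ∧
      (∀ v, w v ≤ (A * direction v).trace.re) ∧
      ∫ v, w v ∂complexGaussian d = A.trace.re * meanThreshold d j₀ ∧
      ∀ s t, ∫ v, (w v : ℂ) * direction v s t ∂complexGaussian d =
        (visibilityBound d / d : ℝ) * A s t +
          ((meanThreshold d j₀ - visibilityBound d / d) / d : ℝ) *
            (A.trace.re * (1 : Matrix (Fin d) (Fin d) ℂ) s t) := by
  obtain ⟨U, x, hU, hU', hx, rfl⟩ := hA.exists_diagonalization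
  have htr : (U * Matrix.diagonal (fun j => (x j : ℂ)) * U.conjTranspose).trace.re = ∑ j, x j := by
    rw [Matrix.trace_mul_comm, ← Matrix.mul_assoc, hU, Matrix.one_mul, Matrix.trace_diagonal,
      ← Complex.ofReal_sum, Complex.ofReal_re]
  let g : (Fin d → ℂ) → ℝ := fun y => ∑ j, x j * threshold d (overlap j y)
  have hg : Measurable g := by fun_prop
  have hg0 : ∀ y, 0 ≤ g y := fun y =>
    Finset.sum_nonneg fun j _ => mul_nonneg (hx j) (threshold_overlap_nonneg j y)
  have hgb : ∀ y, |g y| ≤ ∑ j, x j := fun y => by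
    rw [abs_of_nonneg (hg0 y)]
    exact Finset.sum_le_sum fun j _ =>
      mul_le_of_le_one_right (hx j) (threshold_overlap_le_one j y)
  have hUm : Measurable fun v : Fin d → ℂ => U.conjTranspose.mulVec v := by
    unfold Matrix.mulVec dotProduct
    fun_prop
  have hinv : ∀ y, U.conjTranspose.mulVec (U.mulVec y) = y := fun y => by
    rw [Matrix.mulVec_mulVec, hU, Matrix.one_mulVec]
  have hint : ∀ j, Integrable (fun y => threshold d (overlap j y)) (complexGaussian d) := fun j =>
    integrable_of_overlap (by fun_prop) (threshold_overlap_nonneg j) (threshold_overlap_le_one j)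
  refine ⟨fun v => g (U.conjTranspose.mulVec v), hg.comp hUm, fun v => hg0 _, fun v => ?_, ?_,
    fun s t => ?_⟩
  · have e : (U * Matrix.diagonal (fun j => (x j : ℂ)) * U.conjTranspose * direction v).trace =
        ((∑ j, x j * overlap j (U.conjTranspose.mulVec v) : ℝ) : ℂ) := by
      have h1 := direction_mulVec (U := U.conjTranspose) (by simpa using hU') v
      rw [Matrix.conjTranspose_conjTranspose] at h1
      rw [Matrix.mul_assoc, Matrix.mul_assoc, Matrix.trace_mul_comm, Matrix.mul_assoc,
        Matrix.mul_assoc, ← Matrix.mul_assoc U.conjTranspose, ← h1]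
      simp [Matrix.trace, Matrix.diagonal_mul, direction_self]
    rw [e, Complex.ofReal_re]
    exact Finset.sum_le_sum fun j _ =>
      mul_le_mul_of_nonneg_left (threshold_le (overlap_nonneg j _)) (hx j)
  · rw [htr, ← integral_comp_isometry (Matrix.mulVecLin U) (sqNorm_mulVec hU)
      (F := fun v => g (U.conjTranspose.mulVec v)) (hg.comp hUm).stronglyMeasurable]
    simp only [Matrix.mulVecLin_apply, hinv]
    simp only [g]
    rw [integral_finsetSum _ fun j _ => (hint j).const_mul _, Finset.sum_mul]
    refine Finset.sum_congr rfl fun j _ => ?_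
    rw [integral_const_mul, meanThreshold_eq j₀ j]
    rfl
  · have hFm : Measurable fun v => (g (U.conjTranspose.mulVec v) : ℂ) * direction v s t := by
      have := hg.comp hUm
      fun_prop
    rw [← integral_comp_isometry (Matrix.mulVecLin U) (sqNorm_mulVec hU) hFm.stronglyMeasurable]
    have e : ∀ y, (g (U.conjTranspose.mulVec (Matrix.mulVecLin U y)) : ℂ) *
        direction (Matrix.mulVecLin U y) s t =
        (U * ((g y : ℂ) • direction y) * U.conjTranspose) s t := by
      intro y
      rw [Matrix.mulVecLin_apply, hinv, direction_mulVec hU, Matrix.mul_smul, Matrix.smul_mul,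
        Matrix.smul_apply, smul_eq_mul]
    simp only [e]
    rw [integral_conjugate fun p r => by
      simpa using integrable_mul_direction hg hgb p r]
    have hN : (Matrix.of fun p r => ∫ y, ((g y : ℂ) • direction y) p r ∂complexGaussian d) =
        ((visibilityBound d / d : ℝ) : ℂ) • Matrix.diagonal (fun j => (x j : ℂ)) +
          (((meanThreshold d j₀ - visibilityBound d / d) / d * ∑ j, x j : ℝ) : ℂ) •
            (1 : Matrix (Fin d) (Fin d) ℂ) := by
      ext p r
      have e2 : ∀ y, ((g y : ℂ) • direction y) p r =
          ∑ j, (x j : ℂ) * ((threshold d (overlap j y) : ℂ) * direction y p r) := by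
        intro y
        simp only [g, Matrix.smul_apply, smul_eq_mul, Complex.ofReal_sum, Complex.ofReal_mul,
          Finset.sum_mul, mul_assoc]
      have hint' : ∀ j, Integrable (fun y => (threshold d (overlap j y) : ℂ) * direction y p r)
          (complexGaussian d) := fun j =>
        integrable_mul_direction (F := fun y => threshold d (overlap j y)) (by fun_prop) (C := 1)
          (fun y => by
            rw [abs_of_nonneg (threshold_overlap_nonneg j y)]
            exact threshold_overlap_le_one j y) p r
      simp only [Matrix.of_apply, e2]
      rw [integral_finsetSum _ fun j _ => (hint' j).const_mul _]
      simp only [integral_const_mul, integral_threshold_mul_direction hd, ← Complex.ofReal_mul,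
        ← Complex.ofReal_sum]
      simp only [fun j => meanThreshold_eq j j₀]
      by_cases hpr : p = r
      · subst hpr
        simp only [and_self, Matrix.add_apply, Matrix.smul_apply, Matrix.diagonal_apply_eq,
          Matrix.one_apply_eq, smul_eq_mul, mul_one, if_true, mul_add, Finset.sum_add_distrib,
          ← Finset.sum_mul]
        simp [mul_comm]
      · have : ∀ j, ¬ (p = j ∧ r = j) := fun j h => hpr (h.1.trans h.2.symm)
        simp [hpr, this]
    rw [hN, htr, Matrix.mul_add, Matrix.add_mul, Matrix.mul_smul, Matrix.smul_mul,
      Matrix.mul_smul, Matrix.smul_mul, Matrix.mul_one, hU']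
    simp only [Matrix.add_apply, Matrix.smul_apply, smul_eq_mul]
    push_cast
    ring

/-- The hidden state `a I - b |v⟩⟨v| / ‖v‖²` of the direction `v`, with `a = (1 + b) / d` as
required by the trace; on the null set `v = 0`, the maximally mixed state. -/
def hiddenState (d : ℕ) (b : ℝ) (v : Fin d → ℂ) : Matrix (Fin d) (Fin d) ℂ :=
  if v = 0 then ((1 / d : ℝ) : ℂ) • 1
  else (((1 + b) / d : ℝ) : ℂ) • 1 - (b : ℂ) • direction v

theorem hiddenState_isState {d : ℕ} (hd : 0 < d) {b : ℝ} (hb : 0 ≤ b) (hb' : b * (d - 1) ≤ 1)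
    (v : Fin d → ℂ) : IsState (hiddenState d b v) := by
  have hd0 : (0 : ℝ) < d := by exact_mod_cast hd
  have hdc : (d : ℂ) ≠ 0 := by exact_mod_cast hd.ne'
  unfold hiddenState
  split_ifs with hv
  · refine ⟨Matrix.PosSemidef.one.smul (Complex.zero_le_real.2 (by positivity)), ?_⟩
    simp [hdc]
  · have hproj : (1 - direction v).PosSemidef := by
      have : 1 - direction v = (1 - direction v).conjTranspose * (1 - direction v) := by
        rw [Matrix.conjTranspose_sub, Matrix.conjTranspose_one, direction_conjTranspose,
          Matrix.sub_mul, Matrix.mul_sub, Matrix.mul_sub, direction_mul_self]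
        simp
      rw [this]
      exact Matrix.posSemidef_conjTranspose_mul_self _
    have e : (((1 + b) / d : ℝ) : ℂ) • (1 : Matrix (Fin d) (Fin d) ℂ) - (b : ℂ) • direction v =
        (((1 + b) / d - b : ℝ) : ℂ) • 1 + (b : ℂ) • (1 - direction v) := by
      push_cast
      rw [sub_smul, smul_sub]
      abel
    refine ⟨?_, ?_⟩
    · rw [e]
      refine (Matrix.PosSemidef.one.smul (Complex.zero_le_real.2 ?_)).add
        (hproj.smul (Complex.zero_le_real.2 hb))
      rw [sub_nonneg, le_div_iff₀ hd0]
      linarith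
    · rw [Matrix.trace_sub, Matrix.trace_smul, Matrix.trace_smul, trace_direction hv,
        Matrix.trace_one, Fintype.card_fin]
      push_cast
      simp only [smul_eq_mul]
      field_simp
      ring

theorem measurable_hiddenState {d : ℕ} (b : ℝ) (s t : Fin d) :
    Measurable fun v => hiddenState d b v s t := by
  have : (fun v : Fin d → ℂ => hiddenState d b v s t) = fun v => if v = 0
      then (((1 / d : ℝ) : ℂ) • (1 : Matrix (Fin d) (Fin d) ℂ)) s t
      else (((1 + b) / d : ℝ) : ℂ) * (1 : Matrix (Fin d) (Fin d) ℂ) s t - b * direction v s t := by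
    ext v
    unfold hiddenState
    split_ifs <;> simp
  rw [this]
  exact Measurable.ite (measurableSet_singleton 0) measurable_const (by fun_prop)

/-- A mixture of acceptance functions and of the uniformly random answer gives response functions
that steer the average of the projectors `|v⟩⟨v| / ‖v‖²` to a combination of the effect and the
identity. -/
theorem exists_response {d : ℕ} (hd : 2 ≤ d) :
    ∃ R : (Fin d → ℂ) → (o : ℕ) → POVM (Fin d) (Fin o) → Fin o → ℝ,
      (∀ v o E, (∀ a, 0 ≤ R v o E a) ∧ ∑ a, R v o E a = 1) ∧
      (∀ o E a, Measurable fun v => R v o E a) ∧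
      (∀ o (E : POVM (Fin d) (Fin o)) a,
        ∫ v, R v o E a ∂complexGaussian d = (E.effect a).trace.re / d) ∧
      ∀ o (E : POVM (Fin d) (Fin o)) a s t,
        ∫ v, (R v o E a : ℂ) * direction v s t ∂complexGaussian d =
          (visibilityBound d / d : ℝ) * E.effect a s t +
            (1 / d ^ 2 - visibilityBound d / d / d : ℝ) *
              ((E.effect a).trace.re * (1 : Matrix (Fin d) (Fin d) ℂ) s t) := by
  have hd0 : (0 : ℝ) < d := by exact_mod_cast (by omega : 0 < d)
  have hdc : (d : ℂ) ≠ 0 := by exact_mod_cast hd0.ne'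
  choose w hwm hw0 hwle hwint hwdir using
    fun (A : Matrix (Fin d) (Fin d) ℂ) (hA : A.PosSemidef) =>
      exists_acceptance hd ⟨0, by omega⟩ hA
  set m := meanThreshold d ⟨0, by omega⟩
  set κ := visibilityBound d / d
  let W : (o : ℕ) → POVM (Fin d) (Fin o) → Fin o → (Fin d → ℂ) → ℝ :=
    fun o E a => w (E.effect a) (E.posSemidef a)
  have hWm : ∀ o E a, Measurable (W o E a) := fun o E a => hwm _ _
  have hW0 : ∀ o E a v, 0 ≤ W o E a v := fun o E a v => hw0 _ _ v
  have hWsum : ∀ o E v, ∑ a, W o E a v ≤ 1 := by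
    intro o E v
    refine (Finset.sum_le_sum fun a _ => hwle _ (E.posSemidef a) v).trans ?_
    rw [← Complex.re_sum, ← Matrix.trace_sum, ← Matrix.sum_mul, E.sum_eq_one, Matrix.one_mul]
    exact trace_direction_re_le_one v
  have hW1 : ∀ o E a v, W o E a v ≤ 1 := fun o E a v =>
    (Finset.single_le_sum (fun b _ => hW0 o E b v) (Finset.mem_univ a)).trans (hWsum o E v)
  have htr0 : ∀ o (E : POVM (Fin d) (Fin o)) a, 0 ≤ (E.effect a).trace.re := fun o E a =>
    (Complex.le_def.1 (E.posSemidef a).trace_nonneg).1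
  have htrsum : ∀ o (E : POVM (Fin d) (Fin o)), ∑ a, (E.effect a).trace.re = d := by
    intro o E
    rw [← Complex.re_sum, ← Matrix.trace_sum, E.sum_eq_one, Matrix.trace_one, Fintype.card_fin,
      Complex.natCast_re]
  have hWi : ∀ o E a, Integrable (W o E a) (complexGaussian d) := fun o E a =>
    integrable_of_overlap (hWm o E a) (hW0 o E a) (hW1 o E a)
  have hWd : ∀ o E a s t, Integrable (fun v => (W o E a v : ℂ) * direction v s t)
      (complexGaussian d) := fun o E a s t =>
    integrable_mul_direction (hWm o E a) (C := 1)
      (fun v => by rw [abs_of_nonneg (hW0 o E a v)]; exact hW1 o E a v) s t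
  refine ⟨fun v o E a => W o E a v + (E.effect a).trace.re / d * (1 - ∑ b, W o E b v),
    fun v o E => ⟨fun a => ?_, ?_⟩, fun o E a => ?_, fun o E a => ?_, fun o E a s t => ?_⟩
  · have h1 := hW0 o E a v
    have h2 := htr0 o E a
    have h3 := sub_nonneg.2 (hWsum o E v)
    positivity
  · rw [Finset.sum_add_distrib, ← Finset.sum_mul, ← Finset.sum_div, htrsum, div_self hd0.ne']
    ring
  · have := hWm o E
    fun_prop
  · have hsum : Integrable (fun v => ∑ b, W o E b v) (complexGaussian d) :=
      integrable_finsetSum _ fun b _ => hWi o E b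
    have hdiff : Integrable (fun v => 1 - ∑ b, W o E b v) (complexGaussian d) :=
      (integrable_const _).sub hsum
    dsimp only
    rw [integral_add (hWi o E a) (hdiff.const_mul _), integral_const_mul,
      integral_sub (integrable_const _) hsum, integral_finsetSum _ fun b _ => hWi o E b]
    simp only [W, hwint]
    rw [← Finset.sum_mul, htrsum]
    simp
    field_simp
    ring
  · have e : ∀ v, ((W o E a v + (E.effect a).trace.re / d * (1 - ∑ b, W o E b v) : ℝ) : ℂ) *
        direction v s t = (W o E a v : ℂ) * direction v s t +
          ((E.effect a).trace.re / d : ℝ) * (direction v s t -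
            ∑ b, (W o E b v : ℂ) * direction v s t) := by
      intro v
      rw [← Finset.sum_mul]
      push_cast
      ring
    have hdir : Integrable (fun v => direction v s t) (complexGaussian d) := by
      simpa using integrable_mul_direction (F := fun _ => 1) measurable_const (C := 1)
        (fun _ => by simp) s t
    have hsum1 : ∑ b, E.effect b s t = (1 : Matrix (Fin d) (Fin d) ℂ) s t := by
      rw [← E.sum_eq_one, Matrix.sum_apply]
    have hsum2 : ∑ b, ((E.effect b).trace.re : ℂ) = d := by
      rw [← Complex.ofReal_sum, htrsum, Complex.ofReal_natCast]
    simp only [e]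
    have hsum : Integrable (fun v => ∑ b, (W o E b v : ℂ) * direction v s t)
        (complexGaussian d) := integrable_finsetSum _ fun b _ => hWd o E b s t
    have hdiff : Integrable
        (fun v => direction v s t - ∑ b, (W o E b v : ℂ) * direction v s t)
        (complexGaussian d) := hdir.sub hsum
    rw [integral_add (hWd o E a s t) (hdiff.const_mul _), integral_const_mul,
      integral_sub hdir hsum, integral_finsetSum _ fun b _ => hWd o E b s t, integral_direction (by omega)]
    simp only [W, hwdir]
    rw [Finset.sum_add_distrib, ← Finset.mul_sum, ← Finset.mul_sum, ← Finset.sum_mul, hsum1, hsum2]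
    have hone : (if s = t then (1 / d : ℂ) else 0) =
        1 / d * (1 : Matrix (Fin d) (Fin d) ℂ) s t := by
      rw [Matrix.one_apply]
      split_ifs <;> simp
    rw [hone]
    push_cast
    field_simp
    ring

theorem visibilityBound_pos {d : ℕ} (hd : 2 ≤ d) : 0 < visibilityBound d := by
  have hd' : (2 : ℝ) ≤ d := by exact_mod_cast hd
  have h1 : 0 < 3 * (d : ℝ) - 1 := by linarith
  have h2 : 0 < (d : ℝ) - 1 := by linarith
  unfold visibilityBound
  positivity

/-- Up to the visibility bound, the Werner states have a local hidden state model for all POVMs. -/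
theorem werner_hasLHSModel {d : ℕ} (hd : 2 ≤ d) {η : ℝ} (h0 : 0 ≤ η) (h1 : η ≤ visibilityBound d) :
    HasLHSModel (werner d η) := by
  have hd' : (2 : ℝ) ≤ d := by exact_mod_cast hd
  have hd1 : 0 < (d : ℝ) - 1 := by linarith
  have hd0 : (0 : ℝ) < d := by linarith
  have hvb := visibilityBound_pos hd
  obtain ⟨R, hR, hRm, hRi, hRd⟩ := exists_response hd
  -- This weight turns the coefficient `visibilityBound d / d` of the effect into that of the
  -- Werner state.
  set b : ℝ := η / (visibilityBound d * (d - 1)) with hb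
  have hb0 : 0 ≤ b := by positivity
  have hb1 : b * (d - 1) ≤ 1 := by
    rw [hb, div_mul_eq_mul_div, mul_div_mul_right _ _ hd1.ne']
    exact (div_le_one hvb).2 h1
  refine ⟨Fin d → ℂ, inferInstance, complexGaussian d, R, hiddenState d b, inferInstance, hR, hRm,
    ⟨hiddenState_isState (by omega) hb0 hb1, measurable_hiddenState b⟩, fun o o' E F a c => ?_⟩
  set A := E.effect a with hA
  set B := F.effect c with hB
  have hR1 : ∀ v, |R v o E a| ≤ 1 := fun v => by
    rw [abs_of_nonneg ((hR v o E).1 a), ← (hR v o E).2]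
    exact Finset.single_le_sum (fun i _ => (hR v o E).1 i) (Finset.mem_univ a)
  have hRint : Integrable (fun v => R v o E a) (complexGaussian d) :=
    integrable_of_overlap (hRm o E a) (fun v => (hR v o E).1 a)
      fun v => (le_abs_self _).trans (hR1 v)
  have hdirint : ∀ s t, Integrable (fun v => (R v o E a : ℂ) * direction v s t)
      (complexGaussian d) := fun s t => integrable_mul_direction (hRm o E a) hR1 s t
  have hreal : ∀ {C : Matrix (Fin d) (Fin d) ℂ}, C.PosSemidef → C.trace = (C.trace.re : ℂ) :=
    fun hC => Complex.ext rfl (Complex.le_def.1 hC.trace_nonneg).2.symm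
  have hstat : ∀ᵐ v ∂complexGaussian d, R v o E a * (B * hiddenState d b v).trace.re =
      (1 + b) / d * B.trace.re * R v o E a -
        b * (∑ s, ∑ t, B s t * ((R v o E a : ℂ) * direction v t s)).re := by
    refine (ae_ne_zero_complexGaussian (by omega)).mono fun v hv => ?_
    have e : ∑ s, ∑ t, B s t * ((R v o E a : ℂ) * direction v t s) =
        (R v o E a : ℂ) * (B * direction v).trace := by
      simp only [Matrix.trace, Matrix.diag, Matrix.mul_apply, Finset.mul_sum]
      exact Finset.sum_congr rfl fun s _ => Finset.sum_congr rfl fun t _ => by ring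
    rw [e, hiddenState, if_neg hv, Matrix.mul_sub, Matrix.mul_smul, Matrix.mul_smul,
      Matrix.mul_one, Matrix.trace_sub, Matrix.trace_smul, Matrix.trace_smul, smul_eq_mul,
      smul_eq_mul, Complex.sub_re, Complex.re_ofReal_mul, Complex.re_ofReal_mul,
      Complex.re_ofReal_mul]
    ring
  have hsumint : Integrable (fun v => ∑ s, ∑ t, B s t * ((R v o E a : ℂ) * direction v t s))
      (complexGaussian d) := integrable_finsetSum _ fun s _ => integrable_finsetSum _ fun t _ =>
    (hdirint t s).const_mul _
  have hsum : ∫ v, ∑ s, ∑ t, B s t * ((R v o E a : ℂ) * direction v t s) ∂complexGaussian d =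
      (visibilityBound d / d : ℝ) * (A * B).trace +
        (1 / d ^ 2 - visibilityBound d / d / d : ℝ) * (A.trace.re * B.trace) := by
    have hrow : ∀ s, Integrable (fun v => ∑ t, B s t * ((R v o E a : ℂ) * direction v t s))
        (complexGaussian d) := fun s => integrable_finsetSum _ fun t _ => (hdirint t s).const_mul _
    have hrow' : ∀ s, ∫ v, ∑ t, B s t * ((R v o E a : ℂ) * direction v t s) ∂complexGaussian d =
        ∑ t, B s t * ((visibilityBound d / d : ℝ) * A t s +
          (1 / d ^ 2 - visibilityBound d / d / d : ℝ) *
            (A.trace.re * (1 : Matrix (Fin d) (Fin d) ℂ) t s)) := by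
      intro s
      rw [integral_finsetSum _ fun t _ => (hdirint t s).const_mul _]
      simp only [integral_const_mul, hRd, hA]
    rw [integral_finsetSum _ fun s _ => hrow s, Matrix.trace_mul_comm]
    simp only [hrow']
    simp only [Matrix.trace, Matrix.diag, Matrix.mul_apply, Matrix.one_apply, mul_add,
      Finset.sum_add_distrib, Finset.mul_sum]
    congr 1
    · exact Finset.sum_congr rfl fun s _ => Finset.sum_congr rfl fun t _ => by ring
    · refine Finset.sum_congr rfl fun s _ => ?_
      simp
      ring
  have hre : ∫ v, (∑ s, ∑ t, B s t * ((R v o E a : ℂ) * direction v t s)).re ∂complexGaussian d =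
      visibilityBound d / d * (A * B).trace.re +
        (1 / d ^ 2 - visibilityBound d / d / d) * (A.trace.re * B.trace.re) := by
    have := Complex.reCLM.integral_comp_comm hsumint
    simp only [Complex.reCLM_apply] at this
    rw [this, hsum, Complex.add_re, Complex.re_ofReal_mul, Complex.re_ofReal_mul,
      Complex.re_ofReal_mul]
  have hsumre : Integrable
      (fun v => (∑ s, ∑ t, B s t * ((R v o E a : ℂ) * direction v t s)).re)
      (complexGaussian d) := hsumint.re
  rw [integral_congr_ae hstat, integral_sub (hRint.const_mul _) (hsumre.const_mul _),
    integral_const_mul, integral_const_mul, hRi, hre]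
  have hlhs : (Matrix.trace ((A ⊗ₖ B) * werner d η)).re =
      η / (d * (d - 1)) * (A.trace.re * B.trace.re - (A * B).trace.re) +
        (1 - η) / d ^ 2 * (A.trace.re * B.trace.re) := by
    rw [trace_kronecker_mul_werner, hreal (E.posSemidef a), hreal (F.posSemidef c)]
    have e1 : (η : ℂ) / (d * (d - 1)) = ((η / (d * (d - 1)) : ℝ) : ℂ) := by push_cast; rfl
    have e2 : (1 - (η : ℂ)) / d ^ 2 = (((1 - η) / d ^ 2 : ℝ) : ℂ) := by push_cast; rfl
    rw [e1, e2, ← Complex.ofReal_mul, Complex.add_re, Complex.re_ofReal_mul,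
      Complex.re_ofReal_mul, Complex.sub_re, Complex.ofReal_re]
    simp
  rw [hlhs, hb]
  field_simp
  ring

/-! ### The visibility range -/

/-- Below the bound, `1 - η` is nonnegative, so that the Werner states are states. -/
theorem visibilityBound_le_one {d : ℕ} (hd : 2 ≤ d) : visibilityBound d ≤ 1 := by
  have hd' : (2 : ℝ) ≤ d := by exact_mod_cast hd
  have h1 : ((d : ℝ) - 1) ^ (d - 1) ≤ (d : ℝ) ^ (d - 1) :=
    pow_le_pow_left₀ (by linarith) (by linarith) _
  have h2 : (d : ℝ) ^ d = d * (d : ℝ) ^ (d - 1) := by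
    rw [← pow_succ', Nat.sub_add_cancel (by omega)]
  have h3 : (0 : ℝ) < (d : ℝ) ^ (d - 1) := by positivity
  rw [visibilityBound, ← div_eq_mul_inv, div_div, h2, div_le_one (by positivity)]
  nlinarith [mul_le_mul_of_nonneg_left h1 (by linarith : 0 ≤ 3 * (d : ℝ) - 1),
    mul_nonneg h3.le (sq_nonneg ((d : ℝ) - 1))]

/-- The interval of visibilities is nonempty, since `(1 + 1 / n) ^ n < e < 3 - 1 / (n + 1)` for
`n = d - 1 ≥ 3`; the two remaining dimensions are checked directly. -/
theorem lt_visibilityBound {d : ℕ} (hd : 2 ≤ d) : 1 / ((d : ℝ) + 1) < visibilityBound d := by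
  obtain ⟨n, rfl⟩ : ∃ n, d = n + 1 := ⟨d - 1, by omega⟩
  have key : ((n : ℝ) + 1) ^ (n + 1) < (3 * n + 2) * (n : ℝ) ^ n := by
    rcases (by omega : n = 1 ∨ n = 2 ∨ 3 ≤ n) with rfl | rfl | hn
    · norm_num
    · norm_num
    · have hn' : (3 : ℝ) ≤ n := by exact_mod_cast hn
      have h1 : (1 + 1 / (n : ℝ)) ^ n ≤ Real.exp 1 := by
        have := Real.add_one_le_exp (1 / (n : ℝ))
        calc (1 + 1 / (n : ℝ)) ^ n ≤ Real.exp (1 / n) ^ n :=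
              pow_le_pow_left₀ (by positivity) (by linarith) _
          _ = Real.exp 1 := by
              rw [← Real.exp_nat_mul]
              congr 1
              field_simp
      have h2 := Real.exp_one_lt_d9
      have h3 : ((n : ℝ) + 1) ^ n = (1 + 1 / (n : ℝ)) ^ n * (n : ℝ) ^ n := by
        rw [← mul_pow]
        congr 1
        field_simp
      have h4 : (0 : ℝ) < (n : ℝ) ^ n := by positivity
      rw [pow_succ, h3]
      have h5 : (1 + 1 / (n : ℝ)) ^ n * (n + 1) < 3 * n + 2 := by nlinarith
      nlinarith
  rw [visibilityBound]
  push_cast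
  rw [add_sub_cancel_right, div_lt_div_iff_of_pos_right (by positivity), ← div_eq_mul_inv,
    lt_div_iff₀ (by positivity)]
  calc 1 * ((n : ℝ) + 1) ^ (n + 1) < (3 * n + 2) * (n : ℝ) ^ n := by rw [one_mul]; exact key
    _ = _ := by ring

/-! ### The hierarchy of genuine multipartite correlations -/

theorem liftedWerner_hasLHSModel {d k l : ℕ} (hd : 2 ≤ d) (hk : 1 ≤ k) (hl : 1 ≤ l) {η : ℝ}
    (h0 : 0 ≤ η) (h1 : η ≤ visibilityBound d) : HasLHSModel (liftedWerner d k l η) :=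
  (werner_hasLHSModel hd h0 h1).conjugate (repIsometry_isometry hk) (repIsometry_isometry hl)

theorem liftedWerner_notMem_GMS {d k l : ℕ} (hd : 2 ≤ d) (hk : 1 ≤ k) (hl : 1 ≤ l) {η : ℝ}
    (h0 : 0 ≤ η) (h1 : η ≤ visibilityBound d) :
    toParties (liftedWerner d k l η) ∉ GMS d (k + l) :=
  fun h => h.2 ((liftedWerner_hasLHSModel hd hk hl h0 h1).hasLHSAcross.hybridLHS (by omega)
    (firstParties_mem_directedBipartitions hk hl))

end

theorem mainTheorem2 (d : ℕ) (hd : 2 ≤ d) :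
    (∀ N : ℕ, 2 ≤ N → GMNL d N ⊆ GMS d N ∧ GMS d N ⊂ GME d N) ∧
    1 / ((d : ℝ) + 1) < visibilityBound d ∧
    ∀ k l : ℕ, 1 ≤ k → 1 ≤ l → ∀ η : ℝ, 1 / ((d : ℝ) + 1) < η → η < visibilityBound d →
      toParties (liftedWerner d k l η) ∈ GME d (k + l) ∧
      toParties (liftedWerner d k l η) ∉ GMS d (k + l) ∧
      HasLHSModel (liftedWerner d k l η) := by
  have hmain : ∀ k l : ℕ, 1 ≤ k → 1 ≤ l → ∀ η : ℝ, 1 / ((d : ℝ) + 1) < η →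
      η < visibilityBound d → toParties (liftedWerner d k l η) ∈ GME d (k + l) ∧
        toParties (liftedWerner d k l η) ∉ GMS d (k + l) ∧ HasLHSModel (liftedWerner d k l η) := by
    intro k l hk hl η h0 h1
    have hη : 0 ≤ η := le_trans (by positivity) h0.le
    exact ⟨liftedWerner_mem_GME hd hk hl h0 (h1.le.trans (visibilityBound_le_one hd)),
      liftedWerner_notMem_GMS hd hk hl hη h1.le, liftedWerner_hasLHSModel hd hk hl hη h1.le⟩
  refine ⟨fun N hN => ⟨GMNL_subset_GMS (by omega) N, GMS_subset_GME (by omega) N, fun h => ?_⟩,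
    lt_visibilityBound hd, hmain⟩
  obtain ⟨η, h0, h1⟩ := exists_between (lt_visibilityBound hd)
  obtain ⟨l, rfl⟩ : ∃ l, N = 1 + l := ⟨N - 1, by omega⟩
  obtain ⟨hE, hS, -⟩ := hmain 1 l le_rfl (by omega) η h0 h1
  exact hS (h hE)
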